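/- Write $\mathbb Z_2=\{0,1\}$ for the integers modulo $2$ and, for a set $U$, $D(U)$ for the finitely supported probability distributions on $U$, with $\delta^u\in D(U)$ the point mass at $u$. Let $N\ge 2$ and let $i_k\in\{0,1\}$, $i_k'=1-i_k$ for $k=1,\dots,N$ (indices modulo $N$). Let $X=\tilde C_N$ be the two-dimensional simplicial set generated by $2$-simplices $\sigma_1,\dots,\sigma_N$ with the identifications $d_{i_k'}\sigma_k=d_{i_{k+1}}\sigma_{k+1}$ for all $k$ (a disk triangulated into $N$ triangles with a common interior vertex). Its boundary $\partial\tilde C_N$ is generated by the edges $x_k=d_2\sigma_k$. Let $\beta:X_2\to\mathbb Z_2$ be a normalized $2$-cocycle. A $\beta$-twisted distribution on $X$ is a simplicial map $p:X\to D(N\mathbb Z_2\times_\beta X)$ with $D(\pi)\circ p=\delta$, where the twisted product of the nerve $N\mathbb Z_2$ with $X$ has $n$-simplices $\mathbb Z_2^n\times X_n$, its faces on $2$-simplices are $d_0((a,b),\sigma)=(b+\beta(\sigma),d_0\sigma)$, $d_1((a,b),\sigma)=(a+b,d_1\sigma)$, $d_2((a,b),\sigma)=(a,d_2\sigma)$,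 and $\pi$ is the projection to $X$. Identify $p_x$ and $p_\sigma$ with distributions on $\mathbb Z_2$ and $\mathbb Z_2^2$, with values $p_x^a$ and $p_\sigma^{ab}$. These $p$ form a convex polytope $\mathrm{sDist}_\beta(X)$ in the coordinates $p_\sigma^{ab}$, and a vertex is an extreme point of it. Call $p$ deterministic if it is $\delta\circ s$ for a section $s$ of $\pi$. The deterministic part $Z_p\subset X$ is the simplicial subset generated by the non-degenerate edges $x$ with $p_x$ a point mass and the non-degenerate triangles $\sigma$ with $p_\sigma$ a point mass. The rank of $p$ is the rank of the matrix of those defining inequalities $p_\sigma^{ab}\ge 0$ ($\sigma$ non-degenerate) that are tight at $p$, written in the coordinates $c(x)=p_x^0-p_x^1$, $x$ a non-degenerate edge. If $p|_{Z_p}=\delta^s$, let $\tilde s$ be the extension of $s$ by $0$ to $X_1$, and let $\bar\beta$ be the cocycle on $X/Z_p$ induced by $\beta+\delta\tilde s$. Finally write $[\beta]=\sum_{k}\beta(\sigma_k)\in\mathbb Z_2$ for the class of $\beta$ in $H^2(\tilde C_N,\partial\tilde C_N;\mathbb Z_2)\cong\mathbb Z_2$. 1. If $p$ is a vertex of $\mathrm{sDist}_\beta(\tilde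 C_N)$ and $p$ is not deterministic, then $Z_p=\partial\tilde C_N$, and there are $a_1,\dots,a_N\in\mathbb Z_2$ with $p_{x_k}=\delta^{a_k}$ for all $k$. 2. Let $p\in\mathrm{sDist}_\beta(\tilde C_N)$ be any twisted distribution with $Z_p=\partial\tilde C_N$ and $p_{x_k}=\delta^{a_k}$ for all $k$. Then $[\bar\beta]\in H^2(\tilde C_N/\partial\tilde C_N;\mathbb Z_2)\cong\mathbb Z_2$ is zero if and only if $[\beta]+\sum_k a_k=0$, and $$\operatorname{rank}(p)=\begin{cases}2N & [\bar\beta]=1,\\ 2N-1 & [\bar\beta]=0.\end{cases}$$ Moreover $p$ is a vertex if and only if $[\bar\beta]=1$, equivalently if and only if $[\beta]=1+\sum_k a_k$. In particular, if $[\beta]=0$, then $p$ is a vertex if and only if $\sum_k a_k=1$. 3. Let $N=4$ and $\beta=0$. The vertices of $\mathrm{sDist}(\tilde C_4)$ that are not deterministic are exactly the Popescu–Rohrlich boxes, i.e. the $p$ for which there are $a_1,\dots,a_4\in\mathbb Z_2$ with $\sum_k a_k=1$ such that, for all $k$, $p_{\sigma_k}^{cb}=\tfrac12$ if $c=a_k$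 and $p_{\sigma_k}^{cb}=0$ otherwise. They are also exactly the $p$ with $p_{x_k}=\delta^{a_k}$ for all $k$, for some $a_1,\dots,a_4$ with $\sum_k a_k=1$. -/

import Mathlib

noncomputable section

/-- A simplicial set of dimension two, given by its simplices in dimensions `0, 1, 2` with all
face maps `d`, degeneracy maps `s` and simplicial identities between them. A two-dimensional
simplicial set (all simplices above dimension two are degenerate) is determined by these data, and
a simplicial map out of it into an arbitrary simplicial set is determined by its values in these
dimensions; hence the same structure also serves for targets of such maps, where it keeps the
simplices of dimension at most two. -/
structure TwoSSet where
  X0 : Type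
  X1 : Type
  X2 : Type
  /-- the faces `d_0, d_1 : X_1 → X_0` (target and source) -/
  d1 : Fin 2 → X1 → X0
  /-- the faces `d_0, d_1, d_2 : X_2 → X_1` -/
  d2 : Fin 3 → X2 → X1
  /-- the degeneracy `s_0 : X_0 → X_1` -/
  s0 : X0 → X1
  /-- the degeneracies `s_0, s_1 : X_1 → X_2` -/
  s1 : Fin 2 → X1 → X2
  d0_d1 : ∀ σ, d1 0 (d2 1 σ) = d1 0 (d2 0 σ)
  d0_d2 : ∀ σ, d1 0 (d2 2 σ) = d1 1 (d2 0 σ)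
  d1_d2 : ∀ σ, d1 1 (d2 2 σ) = d1 1 (d2 1 σ)
  d_s : ∀ i v, d1 i (s0 v) = v
  d0_s0 : ∀ x, d2 0 (s1 0 x) = x
  d1_s0 : ∀ x, d2 1 (s1 0 x) = x
  d2_s0 : ∀ x, d2 2 (s1 0 x) = s0 (d1 1 x)
  d0_s1 : ∀ x, d2 0 (s1 1 x) = s0 (d1 0 x)
  d1_s1 : ∀ x, d2 1 (s1 1 x) = x
  d2_s1 : ∀ x, d2 2 (s1 1 x) = x
  s_s : ∀ v, s1 0 (s0 v) = s1 1 (s0 v)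

namespace TwoSSet

open Convexity

/-! ### Simplicial maps, simplicial subsets, quotients -/

/-- Simplicial maps. -/
@[ext]
structure Hom (X Y : TwoSSet) where
  f0 : X.X0 → Y.X0
  f1 : X.X1 → Y.X1
  f2 : X.X2 → Y.X2
  map_d1 : ∀ i x, f0 (X.d1 i x) = Y.d1 i (f1 x)
  map_d2 : ∀ i σ, f1 (X.d2 i σ) = Y.d2 i (f2 σ)
  map_s0 : ∀ v, f1 (X.s0 v) = Y.s0 (f0 v)
  map_s1 : ∀ i x, f2 (X.s1 i x) = Y.s1 i (f1 x)

/-- The identity map. -/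
def Hom.id (X : TwoSSet) : Hom X X :=
  ⟨fun v => v, fun x => x, fun σ => σ, fun _ _ => rfl, fun _ _ => rfl, fun _ => rfl,
    fun _ _ => rfl⟩

/-- Composition `g ∘ f`. -/
def Hom.comp {X Y W : TwoSSet} (g : Hom Y W) (f : Hom X Y) : Hom X W where
  f0 v := g.f0 (f.f0 v)
  f1 x := g.f1 (f.f1 x)
  f2 σ := g.f2 (f.f2 σ)
  map_d1 i x := by rw [f.map_d1, g.map_d1]
  map_d2 i σ := by rw [f.map_d2, g.map_d2]
  map_s0 v := by rw [f.map_s0, g.map_s0]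
  map_s1 i x := by rw [f.map_s1, g.map_s1]

/-- Non-degenerate `1`-simplices. -/
def Nondeg1 (X : TwoSSet) (x : X.X1) : Prop := ∀ v, x ≠ X.s0 v

/-- Non-degenerate `2`-simplices. -/
def Nondeg2 (X : TwoSSet) (σ : X.X2) : Prop := ∀ i x, σ ≠ X.s1 i x

/-- Simplicial subsets. -/
@[ext]
structure Sub (X : TwoSSet) where
  S0 : Set X.X0
  S1 : Set X.X1
  S2 : Set X.X2
  d1_mem : ∀ i, ∀ x ∈ S1, X.d1 i x ∈ S0
  d2_mem : ∀ i, ∀ σ ∈ S2, X.d2 i σ ∈ S1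
  s0_mem : ∀ v ∈ S0, X.s0 v ∈ S1
  s1_mem : ∀ i, ∀ x ∈ S1, X.s1 i x ∈ S2

/-- The simplicial subset generated by a set of `1`-simplices and a set of `2`-simplices. -/
def generatedSub (X : TwoSSet) (A1 : Set X.X1) (A2 : Set X.X2) : Sub X where
  S0 := {v | ∀ Z : Sub X, A1 ⊆ Z.S1 → A2 ⊆ Z.S2 → v ∈ Z.S0}
  S1 := {x | ∀ Z : Sub X, A1 ⊆ Z.S1 → A2 ⊆ Z.S2 → x ∈ Z.S1}
  S2 := {σ | ∀ Z : Sub X, A1 ⊆ Z.S1 → A2 ⊆ Z.S2 → σ ∈ Z.S2}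
  d1_mem i x hx Z h1 h2 := Z.d1_mem i x (hx Z h1 h2)
  d2_mem i σ hσ Z h1 h2 := Z.d2_mem i σ (hσ Z h1 h2)
  s0_mem v hv Z h1 h2 := Z.s0_mem v (hv Z h1 h2)
  s1_mem i x hx Z h1 h2 := Z.s1_mem i x (hx Z h1 h2)

/-- The quotient `X/Z`: in each dimension the simplices of `Z` are identified with each other. -/
abbrev quot (X : TwoSSet) (Z : Sub X) : TwoSSet where
  X0 := Quot fun v w : X.X0 => v ∈ Z.S0 ∧ w ∈ Z.S0
  X1 := Quot fun x y : X.X1 => x ∈ Z.S1 ∧ y ∈ Z.S1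
  X2 := Quot fun σ τ : X.X2 => σ ∈ Z.S2 ∧ τ ∈ Z.S2
  d1 i := Quot.map (X.d1 i) fun x y h => ⟨Z.d1_mem i x h.1, Z.d1_mem i y h.2⟩
  d2 i := Quot.map (X.d2 i) fun x y h => ⟨Z.d2_mem i x h.1, Z.d2_mem i y h.2⟩
  s0 := Quot.map X.s0 fun x y h => ⟨Z.s0_mem x h.1, Z.s0_mem y h.2⟩
  s1 i := Quot.map (X.s1 i) fun x y h => ⟨Z.s1_mem i x h.1, Z.s1_mem i y h.2⟩
  d0_d1 := Quot.ind fun σ => congrArg (Quot.mk _) (X.d0_d1 σ)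
  d0_d2 := Quot.ind fun σ => congrArg (Quot.mk _) (X.d0_d2 σ)
  d1_d2 := Quot.ind fun σ => congrArg (Quot.mk _) (X.d1_d2 σ)
  d_s i := Quot.ind fun v => congrArg (Quot.mk _) (X.d_s i v)
  d0_s0 := Quot.ind fun x => congrArg (Quot.mk _) (X.d0_s0 x)
  d1_s0 := Quot.ind fun x => congrArg (Quot.mk _) (X.d1_s0 x)
  d2_s0 := Quot.ind fun x => congrArg (Quot.mk _) (X.d2_s0 x)
  d0_s1 := Quot.ind fun x => congrArg (Quot.mk _) (X.d0_s1 x)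
  d1_s1 := Quot.ind fun x => congrArg (Quot.mk _) (X.d1_s1 x)
  d2_s1 := Quot.ind fun x => congrArg (Quot.mk _) (X.d2_s1 x)
  s_s := Quot.ind fun v => congrArg (Quot.mk _) (X.s_s v)

/-! ### Cohomology with coefficients in `ℤ/2` -/

/-- Normalized `1`-cochains. -/
def C1 (X : TwoSSet) : Submodule (ZMod 2) (X.X1 → ZMod 2) where
  carrier := {t | ∀ v, t (X.s0 v) = 0}
  zero_mem' _ := rfl
  add_mem' {a b} ha hb v := by simp [ha v, hb v]
  smul_mem' c a ha v := by simp [ha v]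

/-- Normalized `2`-cochains. On a two-dimensional simplicial set each of them is a cocycle, because
every `3`-simplex is degenerate and the coboundary of a normalized cochain is normalized. -/
def C2 (X : TwoSSet) : Submodule (ZMod 2) (X.X2 → ZMod 2) where
  carrier := {β | ∀ i x, β (X.s1 i x) = 0}
  zero_mem' _ _ := rfl
  add_mem' {a b} ha hb i x := by simp [ha i x, hb i x]
  smul_mem' c a ha i x := by simp [ha i x]

/-- The coboundary `(δ t)(σ) = t (d_0 σ) - t (d_1 σ) + t (d_2 σ)`. -/
def coboundary (X : TwoSSet) : X.C1 →ₗ[ZMod 2] X.C2 where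
  toFun t := ⟨fun σ => t.1 (X.d2 0 σ) - t.1 (X.d2 1 σ) + t.1 (X.d2 2 σ), by
    have h : ∀ v, t.1 (X.s0 v) = 0 := t.2
    intro i x
    fin_cases i
    · simp [X.d0_s0, X.d1_s0, X.d2_s0, h]
    · simp [X.d0_s1, X.d1_s1, X.d2_s1, h, CharTwo.add_self_eq_zero]⟩
  map_add' a b := by
    ext σ
    simp only [Submodule.coe_add, Pi.add_apply]
    ring
  map_smul' c a := by
    ext σ
    simp only [Submodule.coe_smul, Pi.smul_apply, smul_eq_mul, RingHom.id_apply]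
    ring

/-- The second cohomology group `H²(X; ℤ/2)` of a two-dimensional simplicial set. -/
abbrev H2 (X : TwoSSet) : Type := X.C2 ⧸ LinearMap.range X.coboundary

/-- The cohomology class `[β]`. -/
def cohClass {X : TwoSSet} (β : X.C2) : H2 X := Submodule.Quotient.mk β

/-! ### Twisted distributions -/

/-- The simplicial set `D(Y)`: its `n`-simplices are the finitely supported probability
distributions on the set of `n`-simplices of `Y`. -/
abbrev dist (Y : TwoSSet) : TwoSSet where
  X0 := StdSimplex ℝ Y.X0
  X1 := StdSimplex ℝ Y.X1
  X2 := StdSimplex ℝ Y.X2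
  d1 i := StdSimplex.map (Y.d1 i)
  d2 i := StdSimplex.map (Y.d2 i)
  s0 := StdSimplex.map Y.s0
  s1 i := StdSimplex.map (Y.s1 i)
  d0_d1 σ := by simp only [StdSimplex.map_map, Y.d0_d1]
  d0_d2 σ := by simp only [StdSimplex.map_map, Y.d0_d2]
  d1_d2 σ := by simp only [StdSimplex.map_map, Y.d1_d2]
  d_s i v := by simp only [StdSimplex.map_map, Y.d_s]; exact StdSimplex.map_id v
  d0_s0 x := by simp only [StdSimplex.map_map, Y.d0_s0]; exact StdSimplex.map_id x
  d1_s0 x := by simp only [StdSimplex.map_map, Y.d1_s0]; exact StdSimplex.map_id x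
  d2_s0 x := by simp only [StdSimplex.map_map, Y.d2_s0]
  d0_s1 x := by simp only [StdSimplex.map_map, Y.d0_s1]
  d1_s1 x := by simp only [StdSimplex.map_map, Y.d1_s1]; exact StdSimplex.map_id x
  d2_s1 x := by simp only [StdSimplex.map_map, Y.d2_s1]; exact StdSimplex.map_id x
  s_s v := by simp only [StdSimplex.map_map, Y.s_s]

lemma map_map_comm {U V V' W : Type} {f : U → V} {g : V → W} {f' : U → V'} {g' : V' → W}
    (h : ∀ u, g (f u) = g' (f' u)) (μ : StdSimplex ℝ U) :
    (μ.map f).map g = (μ.map f').map g' := by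
  simp only [StdSimplex.map_map, h]

/-- The map `D(f) : D(Y) → D(W)`. -/
def distMap {Y W : TwoSSet} (f : Hom Y W) : Hom (dist Y) (dist W) where
  f0 := StdSimplex.map f.f0
  f1 := StdSimplex.map f.f1
  f2 := StdSimplex.map f.f2
  map_d1 i x := map_map_comm (f.map_d1 i) x
  map_d2 i x := map_map_comm (f.map_d2 i) x
  map_s0 x := map_map_comm (f.map_s0) x
  map_s1 i x := map_map_comm (f.map_s1 i) x

/-- The map `δ : Y → D(Y)` sending a simplex to the delta-distribution peaked at it. -/
def delta (Y : TwoSSet) : Hom Y (dist Y) where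
  f0 := StdSimplex.single
  f1 := StdSimplex.single
  f2 := StdSimplex.single
  map_d1 i x := by simp [dist]
  map_d2 i x := by simp [dist]
  map_s0 x := by simp [dist]
  map_s1 i x := by simp [dist]

/-- The twisted product `Nℤ₂ ×_β X`, where `Nℤ₂` is the nerve of `ℤ/2`: its simplices in dimensions
`0, 1, 2` are those of `X` together with a `0`-, `1`-, `2`-tuple of elements of `ℤ/2`. -/
abbrev twist (X : TwoSSet) (β : X.C2) : TwoSSet where
  X0 := X.X0
  X1 := ZMod 2 × X.X1
  X2 := (ZMod 2 × ZMod 2) × X.X2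
  d1 i x := X.d1 i x.2
  d2 i σ := (![σ.1.2 + β.1 σ.2, σ.1.1 + σ.1.2, σ.1.1] i, X.d2 i σ.2)
  s0 v := (0, X.s0 v)
  s1 i x := (![(0, x.1), (x.1, 0)] i, X.s1 i x.2)
  d0_d1 σ := X.d0_d1 σ.2
  d0_d2 σ := X.d0_d2 σ.2
  d1_d2 σ := X.d1_d2 σ.2
  d_s i v := X.d_s i v
  d0_s0 x := by
    have h : β.1 (X.s1 0 x.2) = 0 := β.2 0 x.2
    simp [X.d0_s0, h]
  d1_s0 x := by simp [X.d1_s0]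
  d2_s0 x := by simp [X.d2_s0]
  d0_s1 x := by
    have h : β.1 (X.s1 1 x.2) = 0 := β.2 1 x.2
    simp [X.d0_s1, h]
  d1_s1 x := by simp [X.d1_s1]
  d2_s1 x := by simp [X.d2_s1]
  s_s v := by simp [X.s_s]

/-- The projection `π : Nℤ₂ ×_β X → X`. -/
def proj (X : TwoSSet) (β : X.C2) : Hom (X.twist β) X :=
  ⟨fun v => v, fun x => x.2, fun σ => σ.2, fun _ _ => rfl, fun _ _ => rfl, fun _ => rfl,
    fun _ _ => rfl⟩

/-- A `β`-twisted distribution on `X`: a simplicial map `p : X → D(Nℤ₂ ×_β X)` such that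
`D(π) ∘ p = δ`. -/
structure TwistedDist (X : TwoSSet) (β : X.C2) where
  hom : Hom X (dist (X.twist β))
  proj_comp_hom : (distMap (X.proj β)).comp hom = delta X

namespace TwistedDist

variable {X : TwoSSet} {β : X.C2}

/-- `p` is deterministic: `p = δ ∘ s` for a section `s` of `π : Nℤ₂ ×_β X → X`. -/
def IsDeterministic (p : TwistedDist X β) : Prop :=
  ∃ s : Hom X (X.twist β), (X.proj β).comp s = Hom.id X ∧ p.hom = (delta (X.twist β)).comp s

/-- `p_x = δ^a` for a `1`-simplex `x`. -/
def EdgeEq (p : TwistedDist X β) (x : X.X1) (a : ZMod 2) : Prop :=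
  p.hom.f1 x = StdSimplex.single (a, x)

/-- `p_σ = δ^{ab}` for a `2`-simplex `σ`. -/
def TriEq (p : TwistedDist X β) (σ : X.X2) (ab : ZMod 2 × ZMod 2) : Prop :=
  p.hom.f2 σ = StdSimplex.single (ab, σ)

/-- The probabilities `p_σ^{ab}`. -/
def prob (p : TwistedDist X β) (σ : X.X2) (ab : ZMod 2 × ZMod 2) : ℝ :=
  (p.hom.f2 σ).weights (ab, σ)

/-- `p` is a vertex of the polytope of `β`-twisted distributions on `X`, in the coordinates
`p_σ^{ab}`. -/
def IsVertex (p : TwistedDist X β) : Prop :=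
  p.prob ∈ Set.extremePoints ℝ
    (Set.range (prob : TwistedDist X β → X.X2 → ZMod 2 × ZMod 2 → ℝ))

/-- The deterministic part `Z_p`: the simplicial subset generated by the deterministic
(non-degenerate) edges and triangles. -/
def detPart (p : TwistedDist X β) : Sub X :=
  X.generatedSub {x | X.Nondeg1 x ∧ ∃ a, p.EdgeEq x a} {σ | X.Nondeg2 σ ∧ ∃ ab, p.TriEq σ ab}

/-- The sign `(-1)^a`. -/
def sgn (a : ZMod 2) : ℝ := if a = 0 then 1 else -1

open Classical in
/-- The matrix of the defining inequalities `p_σ^{ab} ≥ 0` that are tight at `p`, in the coordinates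
`c(x) = p_x^0 - p_x^1`, `x` a non-degenerate `1`-simplex. Its rows are indexed by the pairs of a
non-degenerate `2`-simplex `σ` and `(a, b)` with `p_σ^{ab} = 0`, its columns by the non-degenerate
`1`-simplices. The non-degenerate faces of each `σ` are supposed to be distinct. -/
def tightMatrix (p : TwistedDist X β) :
    Matrix {r : X.X2 × (ZMod 2 × ZMod 2) // X.Nondeg2 r.1 ∧ p.prob r.1 r.2 = 0}
      {x : X.X1 // X.Nondeg1 x} ℝ :=
  fun r x =>
    if x.1 = X.d2 0 r.1.1 then sgn (r.1.2.2 + β.1 r.1.1)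
    else if x.1 = X.d2 1 r.1.1 then sgn (r.1.2.1 + r.1.2.2)
    else if x.1 = X.d2 2 r.1.1 then sgn r.1.2.1
    else 0

/-- The rank of a twisted distribution. -/
def rank [Finite X.X1] (p : TwistedDist X β) : ℕ :=
  letI : Fintype {x : X.X1 // X.Nondeg1 x} := Fintype.ofFinite _
  p.tightMatrix.rank

/-! ### The class of the quotient `X/Z_p` -/

lemma map_proj_f1 (p : TwistedDist X β) (x : X.X1) :
    (p.hom.f1 x).map Prod.snd = StdSimplex.single x :=
  congrFun (congrArg Hom.f1 p.proj_comp_hom) x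

lemma edgeEq_s0 (p : TwistedDist X β) (v : X.X0) : p.EdgeEq (X.s0 v) 0 := by
  have h : (p.hom.f0 v).map (fun w : X.X0 => w) = StdSimplex.single v :=
    congrFun (congrArg Hom.f0 p.proj_comp_hom) v
  have h' : p.hom.f0 v = StdSimplex.single (R := ℝ) (M := X.X0) v :=
    (StdSimplex.map_id (R := ℝ) (M := X.X0) (p.hom.f0 v)).symm.trans h
  unfold EdgeEq
  rw [p.hom.map_s0, h']
  exact StdSimplex.map_single _ _

lemma edgeEq_d2 (p : TwistedDist X β) {σ : X.X2} {ab : ZMod 2 × ZMod 2} (h : p.TriEq σ ab)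
    (i : Fin 3) : p.EdgeEq (X.d2 i σ) (![ab.2 + β.1 σ, ab.1 + ab.2, ab.1] i) := by
  unfold EdgeEq
  rw [p.hom.map_d2, h]
  exact StdSimplex.map_single _ _

lemma triEq_s1 (p : TwistedDist X β) {x : X.X1} {a : ZMod 2} (h : p.EdgeEq x a)
    (i : Fin 2) : p.TriEq (X.s1 i x) (![(0, a), (a, 0)] i) := by
  unfold TriEq
  rw [p.hom.map_s1, h]
  exact StdSimplex.map_single _ _

lemma EdgeEq.unique {p : TwistedDist X β} {x : X.X1} {a b : ZMod 2} (ha : p.EdgeEq x a)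
    (hb : p.EdgeEq x b) : a = b := by
  have h := congrArg StdSimplex.weights (ha.symm.trans hb)
  simp only [StdSimplex.weights_single] at h
  have := (Finsupp.single_left_inj (one_ne_zero (α := ℝ))).1 h
  exact congrArg Prod.fst this

/-- The simplicial subset of all simplices on which `p` is a delta-distribution. -/
def allDet (p : TwistedDist X β) : Sub X where
  S0 := Set.univ
  S1 := {x | ∃ a, p.EdgeEq x a}
  S2 := {σ | ∃ ab, p.TriEq σ ab}
  d1_mem _ _ _ := trivial
  d2_mem i _ h := h.elim fun _ h => ⟨_, p.edgeEq_d2 h i⟩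
  s0_mem v _ := ⟨0, p.edgeEq_s0 v⟩
  s1_mem i _ h := h.elim fun _ h => ⟨_, p.triEq_s1 h i⟩

lemma triEq_of_mem_detPart (p : TwistedDist X β) {σ : X.X2} (h : σ ∈ p.detPart.S2) :
    ∃ ab, p.TriEq σ ab :=
  h p.allDet (fun _ hx => hx.2) (fun _ hx => hx.2)

open Classical in
/-- The cochain `s̃` on `X`: on the `1`-simplices of `Z_p` it is the `s` with `p|_{Z_p} = δ^s`, and
it vanishes on the other `1`-simplices. -/
def extCochain (p : TwistedDist X β) : X.C1 :=
  ⟨fun x => if x ∈ p.detPart.S1 ∧ p.EdgeEq x 1 then 1 else 0, by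
    intro v
    refine if_neg fun h => ?_
    exact zero_ne_one ((p.edgeEq_s0 v).unique h.2)⟩

lemma extCochain_eq (p : TwistedDist X β) {x : X.X1} {a : ZMod 2} (hx : x ∈ p.detPart.S1)
    (h : p.EdgeEq x a) : p.extCochain.1 x = a := by
  have ha : ∀ a : ZMod 2, a = 0 ∨ a = 1 := by decide
  rcases ha a with rfl | rfl
  · exact if_neg fun h' => zero_ne_one (h.unique h'.2)
  · exact if_pos ⟨hx, h⟩

lemma twisted_eq_zero (p : TwistedDist X β) {σ : X.X2} (h : σ ∈ p.detPart.S2) :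
    (β + X.coboundary p.extCochain).1 σ = 0 := by
  obtain ⟨ab, hab⟩ := p.triEq_of_mem_detPart h
  have e : ∀ i, p.extCochain.1 (X.d2 i σ) = ![ab.2 + β.1 σ, ab.1 + ab.2, ab.1] i := fun i =>
    p.extCochain_eq (p.detPart.d2_mem i σ h) (p.edgeEq_d2 hab i)
  change β.1 σ + (p.extCochain.1 (X.d2 0 σ) - p.extCochain.1 (X.d2 1 σ)
    + p.extCochain.1 (X.d2 2 σ)) = 0
  rw [e 0, e 1, e 2]
  change β.1 σ + ((ab.2 + β.1 σ) - (ab.1 + ab.2) + ab.1) = 0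
  have key : ∀ a b c : ZMod 2, c + ((b + c) - (a + b) + a) = 0 := by decide
  exact key _ _ _

/-- The cocycle `β̄ = β + ζ(s)` on `X/Z_p`, the one that `β + δ s̃` induces. -/
def quotCocycle (p : TwistedDist X β) : (X.quot p.detPart).C2 :=
  ⟨Quot.lift (fun σ => (β + X.coboundary p.extCochain).1 σ) fun _ _ h =>
      (p.twisted_eq_zero h.1).trans (p.twisted_eq_zero h.2).symm,
    fun i => Quot.ind fun x => (β + X.coboundary p.extCochain).2 i x⟩

end TwistedDist

end TwoSSet

/-! ### The `N`-cycle scenario -/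

open TwoSSet

/-- Vertices of the triangulated disk: the centre and the `N` boundary points. -/
inductive CycleVertex (N : ℕ) : Type
  | centre
  | outer (k : Fin N)

/-- `1`-simplices: the degenerate ones, the interior edges `spoke k`, the boundary edges
`rim k = x_k`. -/
inductive CycleEdge (N : ℕ) : Type
  | const (v : CycleVertex N)
  | spoke (k : Fin N)
  | rim (k : Fin N)

/-- `2`-simplices: the degenerate ones `s_0 s_0 v` and `s_j x` for `x` an interior or a boundary
edge, and the generating triangles `tri k = σ_k`. -/
inductive CycleTri (N : ℕ) : Type
  | const (v : CycleVertex N)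
  | degSpoke (j : Fin 2) (k : Fin N)
  | degRim (j : Fin 2) (k : Fin N)
  | tri (k : Fin N)

/-- The faces `d_0, d_1` of `1`-simplices. All interior edges point to the centre. -/
def cycleD1 {N : ℕ} (i : Fin N → Fin 2) (j : Fin 2) : CycleEdge N → CycleVertex N
  | .const v => v
  | .spoke k => if j = 0 then .centre else .outer k
  | .rim k => .outer (if j = i k then k else finRotate N k)

/-- The degeneracies of `1`-simplices. -/
def cycleS1 {N : ℕ} (j : Fin 2) : CycleEdge N → CycleTri N
  | .const v => .const v
  | .spoke k => .degSpoke j k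
  | .rim k => .degRim j k

/-- The faces of the degenerate `2`-simplex `s_j x`. -/
def cycleDegFace {N : ℕ} (i : Fin N → Fin 2) (j : Fin 2) (x : CycleEdge N) (l : Fin 3) :
    CycleEdge N :=
  if j = 0 then ![x, x, .const (cycleD1 i 1 x)] l else ![.const (cycleD1 i 0 x), x, x] l

/-- The faces `d_0, d_1, d_2` of `2`-simplices. -/
def cycleD2 {N : ℕ} (i : Fin N → Fin 2) (l : Fin 3) : CycleTri N → CycleEdge N
  | .const v => .const v
  | .degSpoke j k => cycleDegFace i j (.spoke k) l
  | .degRim j k => cycleDegFace i j (.rim k) l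
  | .tri k =>
    if l = 2 then .rim k
    else if l = (i k).castSucc then .spoke k
    else .spoke (finRotate N k)

/-- The measurement space of the `N`-cycle scenario. It is generated by triangles `σ_1, …, σ_N`
(indexed by `Fin N`, with cyclic successor `finRotate N`), where for `i'_k` the element of `{0, 1}`
other than `i_k` the faces `d_{i'_k} σ_k` and `d_{i_{k+1}} σ_{k+1}` are identified, giving
`spoke (k + 1)`. The remaining face `d_2 σ_k` is the boundary edge `x_k = rim k`. -/
abbrev cycleSpace (N : ℕ) (i : Fin N → Fin 2) : TwoSSet where
  X0 := CycleVertex N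
  X1 := CycleEdge N
  X2 := CycleTri N
  d1 := cycleD1 i
  d2 := cycleD2 i
  s0 := .const
  s1 := cycleS1
  d0_d1 σ := by
    rcases σ with v | ⟨j, k⟩ | ⟨j, k⟩ | k
    · rfl
    · fin_cases j <;> rfl
    · fin_cases j <;> rfl
    · obtain h | h : i k = 0 ∨ i k = 1 := by omega
      all_goals simp [cycleD2, cycleD1, h]
  d0_d2 σ := by
    rcases σ with v | ⟨j, k⟩ | ⟨j, k⟩ | k
    · rfl
    · fin_cases j <;> rfl
    · fin_cases j <;> rfl
    · obtain h | h : i k = 0 ∨ i k = 1 := by omega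
      all_goals simp [cycleD2, cycleD1, h]
  d1_d2 σ := by
    rcases σ with v | ⟨j, k⟩ | ⟨j, k⟩ | k
    · rfl
    · fin_cases j <;> rfl
    · fin_cases j <;> rfl
    · obtain h | h : i k = 0 ∨ i k = 1 := by omega
      all_goals simp [cycleD2, cycleD1, h]
  d_s _ _ := rfl
  d0_s0 x := by cases x <;> rfl
  d1_s0 x := by cases x <;> rfl
  d2_s0 x := by cases x <;> rfl
  d0_s1 x := by cases x <;> rfl
  d1_s1 x := by cases x <;> rfl
  d2_s1 x := by cases x <;> rfl
  s_s _ := rfl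

instance (N : ℕ) : Finite (CycleVertex N) :=
  Finite.of_injective
    (fun v : CycleVertex N => match v with
      | .centre => (none : Option (Fin N))
      | .outer k => some k)
    (by rintro (_ | _) (_ | _) h <;> simp_all)

instance (N : ℕ) : Finite (CycleEdge N) :=
  Finite.of_injective
    (fun x : CycleEdge N => match x with
      | .const v => (Sum.inl v : CycleVertex N ⊕ (Fin N ⊕ Fin N))
      | .spoke k => Sum.inr (Sum.inl k)
      | .rim k => Sum.inr (Sum.inr k))
    (by rintro (_ | _ | _) (_ | _ | _) h <;> simp_all)

instance (N : ℕ) (i : Fin N → Fin 2) : Finite (cycleSpace N i).X1 :=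
  inferInstanceAs (Finite (CycleEdge N))

/-- The boundary of the disk: the simplicial subset generated by the edges `x_1, …, x_N`. -/
def cycleBoundary (N : ℕ) (i : Fin N → Fin 2) : Sub (cycleSpace N i) :=
  (cycleSpace N i).generatedSub (Set.range (CycleEdge.rim : Fin N → CycleEdge N)) ∅

/-- `p_{x_k} = δ^{a_k}` on all the boundary edges. -/
def BoundaryEq {N : ℕ} {i : Fin N → Fin 2} {β : (cycleSpace N i).C2}
    (p : TwistedDist (cycleSpace N i) β) (a : Fin N → ZMod 2) : Prop :=
  ∀ k, p.EdgeEq (CycleEdge.rim k) (a k)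

/-- The number `∑_k β(σ_k)` in `ℤ/2`. It is the class of `β` in
`H²(disk, boundary; ℤ/2) = ℤ/2`. -/
def cycleClass {N : ℕ} {i : Fin N → Fin 2} (β : (cycleSpace N i).C2) : ZMod 2 :=
  ∑ k : Fin N, β.1 (CycleTri.tri k)

/-- Popescu-Rohrlich boxes (usually for `N = 4`): on each triangle `σ_k` the outcome on the
boundary edge is a fixed `a_k`, the outcome on the interior edges is uniformly random, and the
`a_k` have odd sum. -/
def IsPRBox {N : ℕ} {i : Fin N → Fin 2} {β : (cycleSpace N i).C2}
    (p : TwistedDist (cycleSpace N i) β) : Prop :=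
  ∃ a : Fin N → ZMod 2, ∑ k, a k = 1 ∧
    ∀ k c b, p.prob (CycleTri.tri k) (c, b) = if c = a k then 1 / 2 else 0

end

/-!
A twisted distribution `p` on the triangulated disk is determined by the correlations
`c(x) = p_x⁰ - p_x¹` of its non-degenerate edges (`corr`): Fourier inversion on `ℤ₂²` expresses the
probabilities on a triangle through the correlations of its three faces (`prob_eq_corr`), and
conversely every family of correlations with nonnegative resulting probabilities comes from a
twisted distribution (`exists_corr_eq`). Write `r_k` for the correlation of the boundary edge `x_k`
and `u_k` for that of the interior edge `spoke k`. If the outcomes on `σ_k` are recorded by the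
outcomes `y`, `z` on its two interior edges, the inequalities become, independently of the
orientations `i_k`,
`1 + (-1)^(y+z+β(σ_k)) r_k + (-1)^y u_k + (-1)^z u_{k+1} ≥ 0` (`prob_pairOf`).

A *tight direction* at `p` is a vector along which all inequalities that are tight at `p` stay
tight; these vectors form the kernel of the matrix of tight inequalities. Hence `p` is a vertex if
and only if there is no nonzero tight direction (`isVertex_iff`), and the rank of `p` is `2N` minus
the dimension of the space of tight directions (`rank_add_finrank_tightDirs`).

*Vertices that are not deterministic.* A direction on the interior edges extends to a tight
direction as soon as it vanishes on the deterministic interior edges and satisfies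
`w_{k+1} = ± w_k` wherever `r_k = ±1` forces `u_{k+1} = ± u_k` (`exists_rim_direction`). If some
`r_j` is not `±1`, the cycle of triangles can be cut open at `j`, signs `τ_k` with the required
changes exist on the resulting path, and `w_k = τ_k (1 - |u_k|)` is such a direction. If all `r_k`
are `±1`, then `w_k = u_k (1 - |u_k|)` is one. At a vertex both have to vanish, which leaves
`|u_k| = 1` for all `k`, where `p` is deterministic, or `r_k = ±1` and `u_k = 0` for all `k`
(`corr_of_tightDirs_eq_bot`).

*Distributions that are deterministic exactly on the boundary.* If `r_k = (-1)^{a_k}` and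
`|u_k| < 1`, the tight directions are those that are zero on the boundary and satisfy
`w_{k+1} = (-1)^(β(σ_k) + a_k) w_k` (`mem_tightDirs_iff`). Around the cycle the sign changes by
`(-1)^([β] + ∑ a_k)`, so their space is zero if this is `-1`, and a line if it is `1`. The same
cycle computes the cohomology of the quotient: the induced cocycle has the values `β(σ_k) + a_k`,
and it is a coboundary if and only if their sum vanishes (`cohClass_quotCocycle_eq_zero_iff`).

*Popescu–Rohrlich boxes.* The relation `u_{k+1} = (-1)^(β(σ_k) + a_k) u_k` holds whenever the
boundary edges are deterministic. If the total sign is `-1` it forces `u = 0`, and the probabilities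
on each triangle are then those of a box (`isPRBox_iff`).
-/

noncomputable section

open Convexity TwoSSet

/-! ### Distributions on one and on two bits -/

namespace Convexity.StdSimplex

lemma weights_map_apply {A B : Type*} [Fintype A] [DecidableEq B] (μ : StdSimplex ℝ A) (g : A → B)
    (b : B) : (μ.map g).weights b = ∑ a, if g a = b then μ.weights a else 0 := by
  rw [weights_map, Finsupp.mapDomain, Finsupp.sum_apply, Finsupp.sum_fintype _ _ (by simp)]
  simp only [Finsupp.single_apply]

lemma apply_eq_of_map_eq_single {A B : Type*} {μ : StdSimplex ℝ A} {g : A → B} {b : B}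
    (h : μ.map g = single b) {a : A} (ha : μ.weights a ≠ 0) : g a = b := by
  classical
  by_contra hne
  have h0 : (μ.map g).weights (g a) = 0 := by
    rw [h, weights_single, Finsupp.single_apply, if_neg (Ne.symm hne)]
  rw [weights_map, Finsupp.mapDomain, Finsupp.sum_apply, Finsupp.sum,
    Finset.sum_eq_zero_iff_of_nonneg] at h0
  · have := h0 a (Finsupp.mem_support_iff.2 ha)
    simp at this
    exact ha this
  · intro x _
    rw [Finsupp.single_apply]
    split_ifs
    exacts [μ.weights_nonneg x, le_rfl]

lemma eq_single_of_forall {A : Type*} {μ : StdSimplex ℝ A} {a : A}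
    (h : ∀ x, μ.weights x ≠ 0 → x = a) : μ = single a := by
  rw [← support_weights_eq_singleton]
  refine Finset.eq_singleton_iff_nonempty_unique_mem.2 ⟨μ.support_weights_nonempty, fun x hx => ?_⟩
  exact h x (Finsupp.mem_support_iff.1 hx)

/-- A distribution on a product whose second marginal is a point mass is determined by its first
marginal. -/
lemma map_fst_map_mk {A B : Type*} {μ : StdSimplex ℝ (A × B)} {b : B}
    (h : μ.map Prod.snd = single b) : (μ.map Prod.fst).map (fun a => (a, b)) = μ := by
  rw [map_map]
  ext1
  conv_rhs => rw [← Finsupp.mapDomain_id (v := μ.weights)]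
  refine Finsupp.mapDomain_congr fun x hx => ?_
  have := apply_eq_of_map_eq_single h (Finsupp.mem_support_iff.1 hx)
  exact Prod.ext rfl this.symm

lemma map_mk_injective {A B : Type*} (b : B) :
    Function.Injective fun μ : StdSimplex ℝ A => μ.map fun a => (a, b) := by
  intro μ ν h
  have := congrArg (map Prod.fst) h
  simp only [map_map] at this
  exact (map_id μ).symm.trans (this.trans (map_id ν))

end Convexity.StdSimplex

lemma ZMod.sum_two {M : Type*} [AddCommMonoid M] (f : ZMod 2 → M) : ∑ a, f a = f 0 + f 1 :=
  Fin.sum_univ_two f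

lemma ZMod.eq_zero_or_one : ∀ a : ZMod 2, a = 0 ∨ a = 1 := by decide

namespace TwoSSet.TwistedDist

open StdSimplex

@[simp] lemma sgn_zero : sgn 0 = 1 := if_pos rfl

@[simp] lemma sgn_one : sgn 1 = -1 := if_neg one_ne_zero

lemma sgn_add (a b : ZMod 2) : sgn (a + b) = sgn a * sgn b := by
  have h : (1 + 1 : ZMod 2) = 0 := rfl
  rcases ZMod.eq_zero_or_one a with rfl | rfl <;> rcases ZMod.eq_zero_or_one b with rfl | rfl <;>
    simp [h]

lemma sgn_mul_self (a : ZMod 2) : sgn a * sgn a = 1 := by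
  rcases ZMod.eq_zero_or_one a with rfl | rfl <;> simp

lemma sgn_ne_zero (a : ZMod 2) : sgn a ≠ 0 := fun h => by simpa [h] using sgn_mul_self a

lemma abs_sgn (a : ZMod 2) : |sgn a| = 1 := by
  rcases ZMod.eq_zero_or_one a with rfl | rfl <;> simp

lemma sgn_injective : Function.Injective sgn := by
  intro a b h
  rcases ZMod.eq_zero_or_one a with rfl | rfl <;> rcases ZMod.eq_zero_or_one b with rfl | rfl <;>
    first | rfl | (norm_num at h)

lemma sgn_sum {ι : Type*} (s : Finset ι) (f : ι → ZMod 2) :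
    sgn (∑ k ∈ s, f k) = ∏ k ∈ s, sgn (f k) := by
  classical
  induction s using Finset.induction_on with
  | empty => simp
  | insert k s hk ih => rw [Finset.sum_insert hk, Finset.prod_insert hk, sgn_add, ih]

lemma exists_sgn_of_abs_eq_one {c : ℝ} (h : |c| = 1) : ∃ a, c = sgn a := by
  rcases (abs_eq zero_le_one).1 h with rfl | rfl
  exacts [⟨0, sgn_zero.symm⟩, ⟨1, sgn_one.symm⟩]

/-- The expectation `μ⁰ - μ¹` of the sign of a random bit. -/
def bitCorr (μ : StdSimplex ℝ (ZMod 2)) : ℝ := μ.weights 0 - μ.weights 1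

lemma weights_bit_add (μ : StdSimplex ℝ (ZMod 2)) : μ.weights 0 + μ.weights 1 = 1 := by
  have := μ.total
  rwa [Finsupp.sum_fintype _ _ (by simp), ZMod.sum_two] at this

lemma weights_bit (μ : StdSimplex ℝ (ZMod 2)) (a : ZMod 2) :
    μ.weights a = (1 + sgn a * bitCorr μ) / 2 := by
  have := weights_bit_add μ
  unfold bitCorr
  rcases ZMod.eq_zero_or_one a with rfl | rfl <;> simp <;> linarith

lemma bitCorr_injective : Function.Injective bitCorr := by
  intro μ ν h
  ext a
  rw [weights_bit, weights_bit, h]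

lemma bitCorr_single (a : ZMod 2) : bitCorr (single a) = sgn a := by
  rcases ZMod.eq_zero_or_one a with rfl | rfl <;> simp [bitCorr]

lemma abs_bitCorr_le (μ : StdSimplex ℝ (ZMod 2)) : |bitCorr μ| ≤ 1 := by
  have h0 := μ.weights_nonneg 0
  have h1 := μ.weights_nonneg 1
  have h2 := weights_bit_add μ
  unfold bitCorr
  rw [abs_le]
  constructor <;> linarith

/-- The distribution of a bit whose sign has expectation `c`. -/
def bitDist (c : ℝ) (hc : |c| ≤ 1) : StdSimplex ℝ (ZMod 2) where
  weights := Finsupp.equivFunOnFinite.symm fun a => (1 + sgn a * c) / 2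
  nonneg a := by
    have := abs_le.1 hc
    change 0 ≤ (1 + sgn a * c) / 2
    rcases ZMod.eq_zero_or_one a with rfl | rfl <;> simp <;> linarith
  total := by
    rw [Finsupp.sum_fintype _ _ (by simp), ZMod.sum_two]
    simp
    ring

@[simp] lemma bitCorr_bitDist (c : ℝ) (hc : |c| ≤ 1) : bitCorr (bitDist c hc) = c := by
  simp [bitCorr, bitDist]
  ring

/-- The outcome that a pair `(a, b)` of outcomes on a triangle gives on the face `d_l`, where `t` is
the value of the cocycle on the triangle. -/
def faceOutcome (t : ZMod 2) (l : Fin 3) (ab : ZMod 2 × ZMod 2) : ZMod 2 :=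
  ![ab.2 + t, ab.1 + ab.2, ab.1] l

/-- The pair of outcomes that an outcome `a` on an edge gives on its degeneracy `s_j`. -/
def degOutcome (j : Fin 2) (a : ZMod 2) : ZMod 2 × ZMod 2 := ![(0, a), (a, 0)] j

@[simp] lemma faceOutcome_zero (t ab) : faceOutcome t 0 ab = ab.2 + t := rfl
@[simp] lemma faceOutcome_one (t ab) : faceOutcome t 1 ab = ab.1 + ab.2 := rfl
@[simp] lemma faceOutcome_two (t ab) : faceOutcome t 2 ab = ab.1 := rfl
@[simp] lemma degOutcome_zero (a) : degOutcome 0 a = (0, a) := rfl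
@[simp] lemma degOutcome_one (a) : degOutcome 1 a = (a, 0) := rfl

/-- Fourier inversion on `ℤ₂²`: a distribution of two bits is determined by the signs expected on
the three faces. -/
lemma weights_pair (ν : StdSimplex ℝ (ZMod 2 × ZMod 2)) (t : ZMod 2) (ab : ZMod 2 × ZMod 2) :
    ν.weights ab = (1 + ∑ l, sgn (faceOutcome t l ab) * bitCorr (ν.map (faceOutcome t l))) / 4 := by
  have h1 : ν.weights (0, 0) + ν.weights (0, 1) + (ν.weights (1, 0) + ν.weights (1, 1)) = 1 := by
    have := ν.total
    rwa [Finsupp.sum_fintype _ _ (by simp), Fintype.sum_prod_type, ZMod.sum_two, ZMod.sum_two,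
      ZMod.sum_two] at this
  have h : (1 + 1 : ZMod 2) = 0 := rfl
  simp only [bitCorr, weights_map_apply, Fin.sum_univ_three, Fintype.sum_prod_type, ZMod.sum_two]
  obtain ⟨a, b⟩ := ab
  rcases ZMod.eq_zero_or_one a with rfl | rfl <;> rcases ZMod.eq_zero_or_one b with rfl | rfl <;>
    rcases ZMod.eq_zero_or_one t with rfl | rfl <;>
    simp [h] <;> linarith

/-- The distribution of two bits in which the sign on the face `d_l` has expectation `c l`. -/
def pairDist (t : ZMod 2) (c : Fin 3 → ℝ)
    (hc : ∀ ab, 0 ≤ 1 + ∑ l, sgn (faceOutcome t l ab) * c l) : StdSimplex ℝ (ZMod 2 × ZMod 2) where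
  weights := Finsupp.equivFunOnFinite.symm fun ab =>
    (1 + ∑ l, sgn (faceOutcome t l ab) * c l) / 4
  nonneg ab := div_nonneg (hc ab) (by norm_num)
  total := by
    have h : (1 + 1 : ZMod 2) = 0 := rfl
    rw [Finsupp.sum_fintype _ _ (by simp), Fintype.sum_prod_type, ZMod.sum_two, ZMod.sum_two,
      ZMod.sum_two]
    rcases ZMod.eq_zero_or_one t with rfl | rfl <;> simp [Fin.sum_univ_three, h] <;> ring

lemma bitCorr_map_pairDist (t : ZMod 2) (c : Fin 3 → ℝ) (hc) (l : Fin 3) :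
    bitCorr ((pairDist t c hc).map (faceOutcome t l)) = c l := by
  have h : (1 + 1 : ZMod 2) = 0 := rfl
  simp only [bitCorr, weights_map_apply, pairDist, Fin.sum_univ_three, Fintype.sum_prod_type,
    ZMod.sum_two, Finsupp.equivFunOnFinite_symm_apply_apply]
  fin_cases l <;> rcases ZMod.eq_zero_or_one t with rfl | rfl <;> simp [h] <;> ring

/-! ### Twisted distributions in terms of edge and triangle distributions -/

variable {X : TwoSSet} {β : X.C2}

/-- The distribution `p_x` on `ℤ₂`. -/
def edgeDist (p : TwistedDist X β) (x : X.X1) : StdSimplex ℝ (ZMod 2) :=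
  StdSimplex.map (M := ZMod 2 × X.X1) Prod.fst (p.hom.f1 x)

/-- The distribution `p_σ` on `ℤ₂²`. -/
def triDist (p : TwistedDist X β) (σ : X.X2) : StdSimplex ℝ (ZMod 2 × ZMod 2) :=
  StdSimplex.map (M := (ZMod 2 × ZMod 2) × X.X2) Prod.fst (p.hom.f2 σ)

lemma edgeDist_map (p : TwistedDist X β) (x : X.X1) :
    (p.edgeDist x).map (fun a => (a, x)) = p.hom.f1 x :=
  map_fst_map_mk (congrFun (congrArg Hom.f1 p.proj_comp_hom) x)

lemma triDist_map (p : TwistedDist X β) (σ : X.X2) :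
    (p.triDist σ).map (fun a => (a, σ)) = p.hom.f2 σ :=
  map_fst_map_mk (congrFun (congrArg Hom.f2 p.proj_comp_hom) σ)

lemma prob_eq (p : TwistedDist X β) (σ : X.X2) (ab : ZMod 2 × ZMod 2) :
    p.prob σ ab = (p.triDist σ).weights ab := by
  unfold prob
  rw [← triDist_map, weights_map]
  exact Finsupp.mapDomain_apply (fun a b h => congrArg Prod.fst h) _ _

lemma edgeEq_iff (p : TwistedDist X β) (x : X.X1) (a : ZMod 2) :
    p.EdgeEq x a ↔ p.edgeDist x = single a := by
  unfold EdgeEq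
  rw [← edgeDist_map]
  have : (single (a, x) : StdSimplex ℝ (ZMod 2 × X.X1)) = (single a).map (fun a => (a, x)) := by
    rw [map_single]
  rw [this]
  exact (map_mk_injective x).eq_iff

lemma triEq_iff (p : TwistedDist X β) (σ : X.X2) (ab : ZMod 2 × ZMod 2) :
    p.TriEq σ ab ↔ p.triDist σ = single ab := by
  unfold TriEq
  rw [← triDist_map]
  have : (single (ab, σ) : StdSimplex ℝ ((ZMod 2 × ZMod 2) × X.X2)) =
      (single ab).map (fun a => (a, σ)) := by
    rw [map_single]
  rw [this]
  exact (map_mk_injective σ).eq_iff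

lemma edgeDist_d2 (p : TwistedDist X β) (l : Fin 3) (σ : X.X2) :
    p.edgeDist (X.d2 l σ) = (p.triDist σ).map (faceOutcome (β.1 σ) l) := by
  unfold edgeDist
  rw [p.hom.map_d2, ← triDist_map]
  simp only [map_map]
  rfl

lemma edgeDist_s0 (p : TwistedDist X β) (v : X.X0) : p.edgeDist (X.s0 v) = single 0 :=
  (p.edgeEq_iff _ _).1 (p.edgeEq_s0 v)

/-- The twisted distribution with given distributions on edges and triangles. -/
def ofMarginals (e : X.X1 → StdSimplex ℝ (ZMod 2)) (τ : X.X2 → StdSimplex ℝ (ZMod 2 × ZMod 2))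
    (hs0 : ∀ v, e (X.s0 v) = single 0)
    (hs1 : ∀ j x, τ (X.s1 j x) = (e x).map (degOutcome j))
    (hd : ∀ l σ, (τ σ).map (faceOutcome (β.1 σ) l) = e (X.d2 l σ)) : TwistedDist X β where
  hom :=
    { f0 := single
      f1 x := (e x).map fun a => (a, x)
      f2 σ := (τ σ).map fun ab => (ab, σ)
      map_d1 l x := by simp only [map_map]; exact (map_const _ _).symm
      map_d2 l σ := by rw [← hd]; simp only [map_map]; rfl
      map_s0 v := by rw [hs0]; simp only [map_single]
      map_s1 j x := by rw [hs1]; simp only [map_map]; rfl }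
  proj_comp_hom := by
    apply Hom.ext
    · funext v
      exact map_id _
    · funext x
      exact (map_map _ _ _).trans (map_const _ _)
    · funext σ
      exact (map_map _ _ _).trans (map_const _ _)

lemma edgeDist_ofMarginals (e : X.X1 → StdSimplex ℝ (ZMod 2))
    (τ : X.X2 → StdSimplex ℝ (ZMod 2 × ZMod 2)) (hs0 hs1 hd) (x : X.X1) :
    (ofMarginals (β := β) e τ hs0 hs1 hd).edgeDist x = e x :=
  (map_map _ _ _).trans (map_id _)

/-- The coordinate `c(x) = p_x⁰ - p_x¹`. -/
def corr (p : TwistedDist X β) (x : X.X1) : ℝ := bitCorr (p.edgeDist x)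

lemma corr_s0 (p : TwistedDist X β) (v : X.X0) : p.corr (X.s0 v) = 1 := by
  rw [corr, edgeDist_s0, bitCorr_single, sgn_zero]

lemma edgeEq_iff_corr (p : TwistedDist X β) (x : X.X1) (a : ZMod 2) :
    p.EdgeEq x a ↔ p.corr x = sgn a := by
  rw [edgeEq_iff, corr, ← bitCorr_single, bitCorr_injective.eq_iff]

lemma abs_corr_le (p : TwistedDist X β) (x : X.X1) : |p.corr x| ≤ 1 := abs_bitCorr_le _

lemma prob_eq_corr (p : TwistedDist X β) (σ : X.X2) (ab : ZMod 2 × ZMod 2) :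
    p.prob σ ab = (1 + ∑ l, sgn (faceOutcome (β.1 σ) l ab) * p.corr (X.d2 l σ)) / 4 := by
  rw [prob_eq, weights_pair _ (β.1 σ)]
  simp only [corr, edgeDist_d2]

lemma prob_nonneg (p : TwistedDist X β) (σ : X.X2) (ab : ZMod 2 × ZMod 2) : 0 ≤ p.prob σ ab := by
  rw [prob_eq]
  exact weights_nonneg _

/-- A triangle all of whose edges are deterministic is deterministic. -/
lemma exists_triEq {p : TwistedDist X β} {σ : X.X2} (h : ∀ l, ∃ a, p.EdgeEq (X.d2 l σ) a) :
    ∃ ab, p.TriEq σ ab := by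
  obtain ⟨y, hy⟩ := h 0
  obtain ⟨a, ha⟩ := h 2
  rw [edgeEq_iff, edgeDist_d2] at hy ha
  refine ⟨(a, y - β.1 σ), (p.triEq_iff _ _).2 (eq_single_of_forall fun x hx => ?_)⟩
  have h0 := apply_eq_of_map_eq_single hy hx
  have h2 := apply_eq_of_map_eq_single ha hx
  exact Prod.ext h2 (eq_sub_of_add_eq h0)

lemma isDeterministic_of_forall {p : TwistedDist X β} (h : ∀ x, ∃ a, p.EdgeEq x a) :
    p.IsDeterministic := by
  have h2 : ∀ σ, ∃ ab, p.TriEq σ ab := fun σ => exists_triEq fun l => h _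
  choose t ht using h
  choose g hg using h2
  let s : Hom X (X.twist β) :=
    { f0 := fun v => v
      f1 := fun x => (t x, x)
      f2 := fun σ => (g σ, σ)
      map_d1 := fun _ _ => rfl
      map_d2 := fun l σ => Prod.ext ((ht _).unique (p.edgeEq_d2 (hg σ) l)) rfl
      map_s0 := fun v => Prod.ext ((ht _).unique (p.edgeEq_s0 v)) rfl
      map_s1 := fun j x => by
        refine Prod.ext ?_ rfl
        have := ((p.triEq_iff _ _).1 (hg (X.s1 j x))).symm.trans
          ((p.triEq_iff _ _).1 (p.triEq_s1 (ht x) j))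
        exact (Finsupp.single_left_inj (one_ne_zero (α := ℝ))).1 (congrArg weights this) }
  refine ⟨s, rfl, Hom.ext ?_ (funext ht) (funext hg)⟩
  funext v
  exact (map_id _).symm.trans (congrFun (congrArg Hom.f0 p.proj_comp_hom) v)

lemma IsDeterministic.exists_edgeEq {p : TwistedDist X β} (h : p.IsDeterministic) (x : X.X1) :
    ∃ a, p.EdgeEq x a := by
  obtain ⟨s, hs, hp⟩ := h
  refine ⟨(s.f1 x).1, ?_⟩
  have h2 : (s.f1 x).2 = x := congrFun (congrArg Hom.f1 hs) x
  have h1 : p.hom.f1 x = single (s.f1 x) := congrFun (congrArg Hom.f1 hp) x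
  unfold EdgeEq
  rw [h1]
  exact congrArg single (Prod.ext rfl h2)

/-- Twisted distributions that agree on all edges agree on all triangles. -/
lemma prob_eq_of_corr_eq {p q : TwistedDist X β} (h : p.corr = q.corr) : p.prob = q.prob := by
  funext σ ab
  rw [prob_eq_corr, prob_eq_corr, h]

end TwoSSet.TwistedDist

/-! ### Functions on a cycle with prescribed signs along its steps -/

lemma finRotate_ne_self {N : ℕ} (hN : 2 ≤ N) (k : Fin N) : finRotate N k ≠ k := by
  have := support_finRotate_of_le hN
  exact Equiv.Perm.mem_support.1 (this ▸ Finset.mem_univ k)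

lemma eq_of_finRotate_invariant {N : ℕ} {α : Type*} {f : Fin N → α}
    (h : ∀ k, f (finRotate N k) = f k) (k l : Fin N) : f k = f l := by
  cases N with
  | zero => exact k.elim0
  | succ n =>
    have key : ∀ k : Fin (n + 1), f k = f 0 := by
      intro k
      induction k using Fin.induction with
      | zero => rfl
      | succ m ih =>
        have := h m.castSucc
        rw [finRotate_apply, Fin.coeSucc_eq_succ] at this
        rw [this, ih]
    rw [key k, key l]

/-- The first cohomology of a cycle: a family of bits on the steps is the coboundary of a family of
bits on the points as soon as its sum vanishes. -/
lemma exists_potential {N : ℕ} {e : Fin N → ZMod 2} (he : ∑ k, e k = 0) :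
    ∃ t : Fin N → ZMod 2, ∀ k, t k + t (finRotate N k) = e k := by
  cases N with
  | zero => exact ⟨0, fun k => k.elim0⟩
  | succ n =>
    refine ⟨fun k => Fin.partialSum e k.castSucc, fun k => ?_⟩
    induction k using Fin.lastCases with
    | last =>
      rw [finRotate_last]
      beta_reduce
      have : Fin.partialSum e (Fin.last (n + 1)) = 0 := by
        rw [Fin.partialSum, ← he, ← List.sum_ofFn, Fin.val_last, List.take_of_length_le (by simp)]
      rw [← Fin.succ_last, Fin.partialSum_succ] at this
      rw [Fin.castSucc_zero, Fin.partialSum_zero, add_zero]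
      exact CharTwo.add_eq_zero.1 this
    | cast m =>
      beta_reduce
      rw [finRotate_apply, Fin.coeSucc_eq_succ, ← Fin.succ_castSucc, Fin.partialSum_succ,
        CharTwo.add_cancel_left]

namespace TwoSSet.TwistedDist

/-- A function that changes sign an odd number of times along a cycle vanishes. -/
lemma eq_zero_of_sgn_mul {N : ℕ} {e : Fin N → ZMod 2} (he : ∑ k, e k = 1) {w : Fin N → ℝ}
    (hw : ∀ k, w (finRotate N k) = sgn (e k) * w k) : w = 0 := by
  have habs : ∀ k l, |w k| = |w l| := eq_of_finRotate_invariant (f := fun k => |w k|) fun k => by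
    simp only [hw, abs_mul, abs_sgn, one_mul]
  by_contra hne
  obtain ⟨l, hl⟩ := Function.ne_iff.1 hne
  have hprod : ∏ k, w k ≠ 0 := Finset.prod_ne_zero_iff.2 fun k _ => by
    rw [← abs_ne_zero, habs k l]
    exact abs_ne_zero.2 hl
  -- The product of all values is invariant under rotation, and rotation multiplies it by `-1`.
  have h1 : ∏ k, w (finRotate N k) = ∏ k, w k := Equiv.prod_comp _ _
  simp only [hw, Finset.prod_mul_distrib] at h1
  rw [← sgn_sum, he, sgn_one] at h1
  exact hprod (by linarith)

/-- A function with prescribed sign changes of even total number along a cycle is unique up to a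
factor. -/
lemma exists_eq_mul_sgn {N : ℕ} {e t : Fin N → ZMod 2}
    (ht : ∀ k, t k + t (finRotate N k) = e k) {w : Fin N → ℝ}
    (hw : ∀ k, w (finRotate N k) = sgn (e k) * w k) : ∃ c, ∀ k, w k = c * sgn (t k) := by
  rcases isEmpty_or_nonempty (Fin N) with _ | ⟨⟨l⟩⟩
  · exact ⟨0, isEmptyElim⟩
  refine ⟨w l * sgn (t l), fun k => ?_⟩
  have := eq_of_finRotate_invariant (f := fun k => w k * sgn (t k)) (fun k => by
    simp only [hw, ← ht, sgn_add]
    linear_combination w k * sgn (t k) * sgn_mul_self (t (finRotate N k))) l k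
  rw [this, mul_assoc, sgn_mul_self, mul_one]

end TwoSSet.TwistedDist

/-! ### The polytope of the cycle scenario and its tight directions -/

lemma cycleSpace_nondeg2_iff {N : ℕ} {i : Fin N → Fin 2} {σ : CycleTri N} :
    (cycleSpace N i).Nondeg2 σ ↔ ∃ k, σ = .tri k := by
  constructor
  · intro h
    rcases σ with v | ⟨j, k⟩ | ⟨j, k⟩ | k
    · exact (h 0 (.const v) rfl).elim
    · exact (h j (.spoke k) rfl).elim
    · exact (h j (.rim k) rfl).elim
    · exact ⟨k, rfl⟩
  · rintro ⟨k, rfl⟩ j (v | l | l) h <;> cases h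

namespace TwoSSet.TwistedDist

open StdSimplex

/-- The pair of outcomes on a triangle with cocycle value `t` that gives the outcomes `y` on
`d_ε` and `z` on the other one of the faces `d_0`, `d_1`. The outcome on `d_2` is then
`y + z + t`. -/
def pairOf (ε : Fin 2) (t y z : ZMod 2) : ZMod 2 × ZMod 2 :=
  (y + z + t, if ε = 0 then y + t else z + t)

lemma exists_pairOf_eq : ∀ (ε : Fin 2) (t : ZMod 2) (ab : ZMod 2 × ZMod 2),
    ∃ y z, pairOf ε t y z = ab := by
  decide

variable {N : ℕ} {i : Fin N → Fin 2} {β : (cycleSpace N i).C2}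

lemma pairOf_face (f : CycleEdge N → ℝ) (k : Fin N) (t y z : ZMod 2) :
    ∑ l, sgn (faceOutcome t l (pairOf (i k) t y z)) * f (cycleD2 i l (.tri k)) =
      sgn (y + z + t) * f (.rim k) + sgn y * f (.spoke k) + sgn z * f (.spoke (finRotate N k)) := by
  have h1 : ∀ y z t : ZMod 2, y + z + t + (y + t) = z := by decide
  have h2 : ∀ y z t : ZMod 2, y + z + t + (z + t) = y := by decide
  have h3 : ∀ y t : ZMod 2, y + t + t = y := by decide
  rw [Fin.sum_univ_three]
  obtain h | h : i k = 0 ∨ i k = 1 := by omega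
  · simp [cycleD2, pairOf, h, h1, h3]
    ring
  · simp [cycleD2, pairOf, h, h2, h3]
    ring

/-- In terms of the outcomes on the two interior edges, the probabilities on a triangle do not
depend on the orientation `i_k`. -/
lemma prob_pairOf (p : TwistedDist (cycleSpace N i) β) (k : Fin N) (y z : ZMod 2) :
    p.prob (.tri k) (pairOf (i k) (β.1 (.tri k)) y z) =
      (1 + (sgn (y + z + β.1 (.tri k)) * p.corr (.rim k) + sgn y * p.corr (.spoke k) +
        sgn z * p.corr (.spoke (finRotate N k)))) / 4 := by
  rw [prob_eq_corr, ← pairOf_face p.corr]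

/-- Every point of the polytope cut out by the inequalities on the triangles comes from a twisted
distribution. -/
lemma exists_corr_eq (r u : Fin N → ℝ)
    (h : ∀ k y z, 0 ≤ 1 + (sgn (y + z + β.1 (CycleTri.tri k)) * r k + sgn y * u k +
      sgn z * u (finRotate N k))) :
    ∃ p : TwistedDist (cycleSpace N i) β,
      (∀ k, p.corr (.rim k) = r k) ∧ ∀ k, p.corr (.spoke k) = u k := by
  have h2 : (1 + 1 : ZMod 2) = 0 := rfl
  have hall : ∀ k, |r k| ≤ 1 ∧ |u k| ≤ 1 := fun k => by
    have h00 := h k 0 0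
    have h01 := h k 0 1
    have h10 := h k 1 0
    have h11 := h k 1 1
    rw [abs_le, abs_le]
    rcases ZMod.eq_zero_or_one (β.1 (CycleTri.tri k)) with h | h <;> simp [h, h2] at * <;>
      refine ⟨⟨?_, ?_⟩, ?_, ?_⟩ <;> linarith
  let c : CycleEdge N → ℝ := fun x => match x with
    | .const _ => 1
    | .spoke k => u k
    | .rim k => r k
  have hc : ∀ x, |c x| ≤ 1 := by
    rintro (v | k | k)
    exacts [by simp [c], (hall k).2, (hall k).1]
  let e : CycleEdge N → StdSimplex ℝ (ZMod 2) := fun x => bitDist (c x) (hc x)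
  have he : ∀ v, e (.const v) = single 0 := fun v => bitCorr_injective (by
    rw [bitCorr_bitDist, bitCorr_single, sgn_zero])
  have hpos : ∀ k ab, 0 ≤ 1 + ∑ l, sgn (faceOutcome (β.1 (CycleTri.tri k)) l ab) *
      c (cycleD2 i l (.tri k)) := fun k ab => by
    obtain ⟨y, z, rfl⟩ := exists_pairOf_eq (i k) (β.1 (CycleTri.tri k)) ab
    rw [pairOf_face]
    exact h k y z
  let τ : CycleTri N → StdSimplex ℝ (ZMod 2 × ZMod 2) := fun σ => match σ with
    | .const _ => single (0, 0)
    | .degSpoke j k => (e (.spoke k)).map (degOutcome j)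
    | .degRim j k => (e (.rim k)).map (degOutcome j)
    | .tri k => pairDist (β.1 (CycleTri.tri k)) (fun l => c (cycleD2 i l (.tri k))) (hpos k)
  have hdeg : ∀ j x l, ((e x).map (degOutcome j)).map (faceOutcome 0 l) =
      e (cycleDegFace i j x l) := by
    intro j x l
    have hid : (e x).map (fun a => a) = e x := map_id _
    rw [map_map]
    fin_cases j <;> fin_cases l <;> simp [cycleDegFace, he, hid]
  have hs1 : ∀ j x, τ (cycleS1 j x) = (e x).map (degOutcome j) := by
    rintro j (v | k | k)
    · change single (0, 0) = _
      rw [he v, map_single]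
      fin_cases j <;> rfl
    · rfl
    · rfl
  have hβ : ∀ j x, β.1 (cycleS1 j x) = 0 := β.2
  refine ⟨ofMarginals (X := cycleSpace N i) e τ he hs1 ?_, fun k => ?_, fun k => ?_⟩
  · rintro l (v | ⟨j, k⟩ | ⟨j, k⟩ | k)
    · have h0 : β.1 (CycleTri.const v) = 0 := hβ 0 (.const v)
      change (single (0, 0)).map _ = e (.const v)
      rw [he v, map_single, h0]
      fin_cases l <;> rfl
    · have h0 : β.1 (CycleTri.degSpoke j k) = 0 := hβ j (.spoke k)
      rw [h0]
      exact hdeg j (.spoke k) l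
    · have h0 : β.1 (CycleTri.degRim j k) = 0 := hβ j (.rim k)
      rw [h0]
      exact hdeg j (.rim k) l
    · exact bitCorr_injective ((bitCorr_map_pairDist _ _ _ _).trans (bitCorr_bitDist _ _).symm)
  · rw [corr, edgeDist_ofMarginals]
    exact bitCorr_bitDist _ _
  · rw [corr, edgeDist_ofMarginals]
    exact bitCorr_bitDist _ _

lemma corr_eq_of_prob_eq {X : TwoSSet} {β : X.C2} {p q : TwistedDist X β} (h : p.prob = q.prob) :
    p.corr = q.corr := by
  funext x
  have : p.triDist (X.s1 0 x) = q.triDist (X.s1 0 x) := by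
    ext ab
    rw [← prob_eq, ← prob_eq, h]
  rw [← X.d1_s0 x, corr, corr, edgeDist_d2, edgeDist_d2, this]

lemma corr_ext {p q : TwistedDist (cycleSpace N i) β} (hr : ∀ k, p.corr (.rim k) = q.corr (.rim k))
    (hu : ∀ k, p.corr (.spoke k) = q.corr (.spoke k)) : p.corr = q.corr := by
  funext x
  rcases x with v | k | k
  exacts [(p.corr_s0 v).trans (q.corr_s0 v).symm, hu k, hr k]

/-- The directions `(ρ, w)`, with `ρ` on the boundary edges and `w` on the interior ones, along
which all inequalities that are tight at `p` stay tight. -/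
def tightDirs (p : TwistedDist (cycleSpace N i) β) : Submodule ℝ ((Fin N → ℝ) × (Fin N → ℝ)) where
  carrier := {d | ∀ k y z, p.prob (.tri k) (pairOf (i k) (β.1 (.tri k)) y z) = 0 →
    sgn (y + z + β.1 (.tri k)) * d.1 k + sgn y * d.2 k + sgn z * d.2 (finRotate N k) = 0}
  zero_mem' _ _ _ _ := by simp
  add_mem' {d d'} hd hd' k y z h := by
    have h1 := hd k y z h
    have h2 := hd' k y z h
    simp only [Prod.fst_add, Prod.snd_add, Pi.add_apply]
    linear_combination h1 + h2
  smul_mem' a d hd k y z h := by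
    have h1 := hd k y z h
    simp only [Prod.smul_fst, Prod.smul_snd, Pi.smul_apply, smul_eq_mul]
    linear_combination a * h1

/-- Finitely many inequalities survive a small step along a direction that keeps the tight ones
tight. -/
lemma exists_pos_mul_abs_le {ι : Type*} [Finite ι] {A L : ι → ℝ} (hA : ∀ j, 0 ≤ A j)
    (h : ∀ j, A j = 0 → L j = 0) : ∃ t : ℝ, 0 < t ∧ ∀ j, t * |L j| ≤ A j := by
  have key : ∀ j, ∀ᶠ t : ℝ in nhdsWithin 0 (Set.Ioi 0), t * |L j| ≤ A j := by
    intro j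
    rcases (hA j).eq_or_lt with h0 | h0
    · simp [h j h0.symm, ← h0]
    · have : Filter.Tendsto (fun t : ℝ => t * |L j|) (nhds 0) (nhds (0 * |L j|)) :=
        (continuous_id.mul continuous_const).tendsto 0
      rw [zero_mul] at this
      filter_upwards [nhdsWithin_le_nhds (this.eventually (gt_mem_nhds h0))] with t ht
      exact ht.le
  have hpos : ∀ᶠ t : ℝ in nhdsWithin 0 (Set.Ioi 0), 0 < t := eventually_mem_nhdsWithin
  obtain ⟨t, ht, hpt⟩ := ((Filter.eventually_all.2 key).and hpos).exists
  exact ⟨t, hpt, ht⟩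

/-- A point of the polytope is a vertex if and only if no direction keeps all tight inequalities
tight. -/
lemma isVertex_iff (p : TwistedDist (cycleSpace N i) β) : p.IsVertex ↔ p.tightDirs = ⊥ := by
  unfold IsVertex
  rw [mem_extremePoints_iff_left, Submodule.eq_bot_iff]
  refine ⟨fun h d hd => ?_, fun h => ⟨⟨p, rfl⟩, ?_⟩⟩
  · obtain ⟨t, ht, hle⟩ := exists_pos_mul_abs_le
      (A := fun j : Fin N × ZMod 2 × ZMod 2 =>
        4 * p.prob (.tri j.1) (pairOf (i j.1) (β.1 (.tri j.1)) j.2.1 j.2.2))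
      (L := fun j => sgn (j.2.1 + j.2.2 + β.1 (.tri j.1)) * d.1 j.1 + sgn j.2.1 * d.2 j.1 +
        sgn j.2.2 * d.2 (finRotate N j.1))
      (fun j => by simpa using p.prob_nonneg _ _)
      (fun j hj => hd _ _ _ (by simpa using hj))
    have feas : ∀ s : ℝ, |s| = t → ∃ q : TwistedDist (cycleSpace N i) β,
        (∀ k, q.corr (.rim k) = p.corr (.rim k) + s * d.1 k) ∧
        ∀ k, q.corr (.spoke k) = p.corr (.spoke k) + s * d.2 k := fun s hs =>
      exists_corr_eq _ _ fun k y z => by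
        have h1 := hle (k, y, z)
        simp only [prob_pairOf] at h1
        rw [← hs, ← abs_mul] at h1
        have := (abs_le.1 h1).1
        linarith
    -- Steps of equal length in both directions exhibit `p` as a midpoint.
    obtain ⟨q, hqr, hqu⟩ := feas t (abs_of_pos ht)
    obtain ⟨q', hqr', hqu'⟩ := feas (-t) (by rw [abs_neg, abs_of_pos ht])
    have hmid : ∀ x, p.corr x = 1 / 2 * q.corr x + 1 / 2 * q'.corr x := by
      rintro (v | k | k)
      · have hc := fun p : TwistedDist (cycleSpace N i) β => p.corr_s0 v
        change ∀ p : TwistedDist (cycleSpace N i) β, p.corr (.const v) = 1 at hc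
        rw [hc, hc, hc]
        norm_num
      · rw [hqu, hqu']
        ring
      · rw [hqr, hqr']
        ring
    have hqp := h.2 q.prob ⟨q, rfl⟩ q'.prob ⟨q', rfl⟩
      ⟨1 / 2, 1 / 2, by norm_num, by norm_num, by norm_num, by
        funext σ ab
        simp only [Pi.add_apply, Pi.smul_apply, smul_eq_mul, prob_eq_corr, Fin.sum_univ_three, hmid]
        ring⟩
    have hc := corr_eq_of_prob_eq hqp
    refine Prod.ext (funext fun k => ?_) (funext fun k => ?_)
    · have := hqr k
      rw [hc] at this
      simpa [ht.ne'] using this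
    · have := hqu k
      rw [hc] at this
      simpa [ht.ne'] using this
  · rintro _ ⟨q, rfl⟩ _ ⟨q', rfl⟩ ⟨a, b, ha, hb, -, hab⟩
    -- An inequality tight at `p` is tight at `q`, so `q - p` is a tight direction.
    have hd := h (fun k => q.corr (.rim k) - p.corr (.rim k),
        fun k => q.corr (.spoke k) - p.corr (.spoke k)) fun k y z h0 => by
      have h1 := congrFun (congrFun hab (.tri k)) (pairOf (i k) (β.1 (.tri k)) y z)
      simp only [Pi.add_apply, Pi.smul_apply, smul_eq_mul, h0] at h1
      have h2 := mul_nonneg ha.le (q.prob_nonneg (.tri k) (pairOf (i k) (β.1 (.tri k)) y z))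
      have h3 := mul_nonneg hb.le (q'.prob_nonneg (.tri k) (pairOf (i k) (β.1 (.tri k)) y z))
      have h4 : q.prob (.tri k) (pairOf (i k) (β.1 (.tri k)) y z) = 0 :=
        (mul_eq_zero.1 (le_antisymm (by linarith) h2)).resolve_left ha.ne'
      rw [prob_pairOf] at h0 h4
      linarith
    refine prob_eq_of_corr_eq (corr_ext (fun k => ?_) fun k => ?_)
    · exact sub_eq_zero.1 (congrFun (congrArg Prod.fst hd) k)
    · exact sub_eq_zero.1 (congrFun (congrArg Prod.snd hd) k)

/-! ### The rank -/

open Classical in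
/-- If the faces of `σ` are distinct and non-degenerate, a row of the matrix of tight inequalities at
`σ` is the linear part of the formula for `4 p_σ^{ab}`. -/
lemma tightMatrix_mulVec {X : TwoSSet} {β : X.C2} [Fintype {x : X.X1 // X.Nondeg1 x}]
    (p : TwistedDist X β) (d : {x : X.X1 // X.Nondeg1 x} → ℝ)
    (r : {r : X.X2 × (ZMod 2 × ZMod 2) // X.Nondeg2 r.1 ∧ p.prob r.1 r.2 = 0})
    (hn : ∀ l, X.Nondeg1 (X.d2 l r.1.1)) (hinj : Function.Injective fun l => X.d2 l r.1.1) :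
    p.tightMatrix.mulVec d r =
      ∑ l, sgn (faceOutcome (β.1 r.1.1) l r.1.2) * d ⟨X.d2 l r.1.1, hn l⟩ := by
  have h01 : X.d2 0 r.1.1 ≠ X.d2 1 r.1.1 := hinj.ne (by decide)
  have h02 : X.d2 0 r.1.1 ≠ X.d2 2 r.1.1 := hinj.ne (by decide)
  have h12 : X.d2 1 r.1.1 ≠ X.d2 2 r.1.1 := hinj.ne (by decide)
  have hrow : ∀ x, p.tightMatrix r x * d x =
      ∑ l, if x = ⟨X.d2 l r.1.1, hn l⟩ then sgn (faceOutcome (β.1 r.1.1) l r.1.2) * d x else 0 := by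
    rintro ⟨x, hx⟩
    simp only [tightMatrix, Fin.sum_univ_three, Subtype.mk.injEq]
    split_ifs <;> simp_all
  rw [Matrix.mulVec, dotProduct, Finset.sum_congr rfl fun x _ => hrow x, Finset.sum_comm]
  simp

/-- The non-degenerate edges are the boundary edges and the interior edges. -/
def nondegEquiv (N : ℕ) (i : Fin N → Fin 2) :
    Fin N ⊕ Fin N ≃ {x : CycleEdge N // (cycleSpace N i).Nondeg1 x} where
  toFun := Sum.elim (fun k => ⟨.rim k, fun _ h => by cases h⟩)
    fun k => ⟨.spoke k, fun _ h => by cases h⟩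
  invFun x := match x with
    | ⟨.const v, h⟩ => (h v rfl).elim
    | ⟨.spoke k, _⟩ => .inr k
    | ⟨.rim k, _⟩ => .inl k
  left_inv x := by rcases x with k | k <;> rfl
  right_inv x := by
    rcases x with ⟨v | k | k, h⟩
    exacts [(h v rfl).elim, rfl, rfl]

lemma nondeg1_cycleD2 (l : Fin 3) (k : Fin N) :
    (cycleSpace N i).Nondeg1 (cycleD2 i l (.tri k)) := by
  intro v h
  change cycleD2 i l (.tri k) = .const v at h
  simp only [cycleD2] at h
  split_ifs at h

lemma cycleD2_tri_injective (hN : 2 ≤ N) (k : Fin N) :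
    Function.Injective fun l => cycleD2 i l (.tri k) := by
  have h1 := finRotate_ne_self hN k
  intro l l' h
  obtain hi | hi : i k = 0 ∨ i k = 1 := by omega
  all_goals
    fin_cases l <;> fin_cases l' <;> simp [cycleD2, hi, h1, h1.symm, -finRotate_apply] at h ⊢

lemma rank_add_finrank_tightDirs (hN : 2 ≤ N) (p : TwistedDist (cycleSpace N i) β) :
    p.rank + Module.finrank ℝ p.tightDirs = 2 * N := by
  classical
  let _ : Fintype {x : (cycleSpace N i).X1 // (cycleSpace N i).Nondeg1 x} := Fintype.ofFinite _
  let E : ({x : (cycleSpace N i).X1 // (cycleSpace N i).Nondeg1 x} → ℝ) ≃ₗ[ℝ]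
      (Fin N → ℝ) × (Fin N → ℝ) :=
    (LinearEquiv.funCongrLeft ℝ ℝ (nondegEquiv N i)).trans
      (LinearEquiv.sumArrowLequivProdArrow (Fin N) (Fin N) ℝ ℝ)
  have hE : p.tightMatrix.mulVecLin.ker = p.tightDirs.comap E.toLinearMap := by
    ext d
    have hface : ∀ k y z, ∑ l, sgn (faceOutcome (β.1 (.tri k)) l
        (pairOf (i k) (β.1 (.tri k)) y z)) * d ⟨cycleD2 i l (.tri k), nondeg1_cycleD2 l k⟩ =
        sgn (y + z + β.1 (.tri k)) * (E d).1 k + sgn y * (E d).2 k +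
          sgn z * (E d).2 (finRotate N k) := fun k y z => by
      have := pairOf_face (i := i)
        (fun x => if h : (cycleSpace N i).Nondeg1 x then d ⟨x, h⟩ else 0) k (β.1 (.tri k)) y z
      have hs : ∀ k, (cycleSpace N i).Nondeg1 (CycleEdge.spoke k) := fun _ _ h => by cases h
      have hr : ∀ k, (cycleSpace N i).Nondeg1 (CycleEdge.rim k) := fun _ _ h => by cases h
      simp only [dif_pos (hs _), dif_pos (hr _), dif_pos (nondeg1_cycleD2 _ _)] at this
      exact this
    rw [LinearMap.mem_ker, Matrix.mulVecLin_apply, Submodule.mem_comap]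
    constructor
    · intro h k y z h0
      have hk : (cycleSpace N i).Nondeg2 (.tri k) := cycleSpace_nondeg2_iff.2 ⟨k, rfl⟩
      have h1 := congrFun h ⟨(.tri k, pairOf (i k) (β.1 (.tri k)) y z), hk, h0⟩
      rw [tightMatrix_mulVec p d _ (fun l => nondeg1_cycleD2 l k) (cycleD2_tri_injective hN k)] at h1
      exact (hface k y z).symm.trans h1
    · intro h
      funext ⟨⟨σ, ab⟩, hσ, h0⟩
      obtain ⟨k, rfl⟩ := cycleSpace_nondeg2_iff.1 hσ
      rw [tightMatrix_mulVec p d _ (fun l => nondeg1_cycleD2 l k) (cycleD2_tri_injective hN k)]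
      obtain ⟨y, z, rfl⟩ := exists_pairOf_eq (i k) (β.1 (.tri k)) ab
      exact (hface k y z).trans (h k y z h0)
  have hfin : Module.finrank ℝ p.tightMatrix.mulVecLin.ker = Module.finrank ℝ p.tightDirs := by
    rw [hE]
    exact (E.ofSubmodule' p.tightDirs).finrank_eq
  have hcard : Fintype.card {x : (cycleSpace N i).X1 // (cycleSpace N i).Nondeg1 x} = 2 * N := by
    rw [← Fintype.card_congr (nondegEquiv N i), Fintype.card_sum, Fintype.card_fin, two_mul]
  have := p.tightMatrix.mulVecLin.finrank_range_add_finrank_ker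
  rw [Module.finrank_fintype_fun_eq_card, hcard, hfin] at this
  exact this

/-! ### Vertices of the polytope -/

/-- The inequalities on a triangle, in terms of the outcomes on its interior edges. -/
lemma tri_nonneg (p : TwistedDist (cycleSpace N i) β) (k : Fin N) (y z : ZMod 2) :
    0 ≤ 1 + (sgn (y + z + β.1 (.tri k)) * p.corr (.rim k) + sgn y * p.corr (.spoke k) +
      sgn z * p.corr (.spoke (finRotate N k))) := by
  have := p.prob_nonneg (.tri k) (pairOf (i k) (β.1 (.tri k)) y z)
  rw [prob_pairOf] at this
  linarith

/-- On a triangle whose boundary edge is deterministic the interior edges are perfectly correlated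
or anticorrelated. -/
lemma corr_spoke_finRotate {p : TwistedDist (cycleSpace N i) β} {k : Fin N} {a : ZMod 2}
    (h : p.corr (.rim k) = sgn a) :
    p.corr (.spoke (finRotate N k)) = sgn (β.1 (.tri k) + a) * p.corr (.spoke k) := by
  have h1 := tri_nonneg p k 0 (β.1 (.tri k) + a + 1)
  have h2 := tri_nonneg p k 1 (β.1 (.tri k) + a)
  have e1 : ∀ b a : ZMod 2, 0 + (b + a + 1) + b = a + 1 := by decide
  have e2 : ∀ b a : ZMod 2, 1 + (b + a) + b = a + 1 := by decide
  have s1 := sgn_mul_self a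
  have s2 := sgn_mul_self (β.1 (.tri k) + a)
  rw [h, e1, sgn_add _ 1, sgn_add _ 1, sgn_one, sgn_zero] at h1
  rw [h, e2, sgn_add _ 1, sgn_one] at h2
  have h3 : p.corr (.spoke k) =
      sgn (β.1 (.tri k) + a) * p.corr (.spoke (finRotate N k)) := by
    linarith
  rw [h3]
  linear_combination -p.corr (.spoke (finRotate N k)) * s2

lemma abs_corr_spoke_finRotate {p : TwistedDist (cycleSpace N i) β} {k : Fin N}
    (h : |p.corr (.rim k)| = 1) :
    |p.corr (.spoke (finRotate N k))| = |p.corr (.spoke k)| := by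
  obtain ⟨a, ha⟩ := exists_sgn_of_abs_eq_one h
  rw [corr_spoke_finRotate ha, abs_mul, abs_sgn, one_mul]

lemma isDeterministic_of_abs_corr_spoke {p : TwistedDist (cycleSpace N i) β}
    (h : ∀ k, |p.corr (.spoke k)| = 1) : p.IsDeterministic := by
  apply isDeterministic_of_forall
  rintro (v | k | k)
  · exact ⟨0, p.edgeEq_s0 v⟩
  · obtain ⟨a, ha⟩ := exists_sgn_of_abs_eq_one (h k)
    exact ⟨a, (p.edgeEq_iff_corr _ _).2 ha⟩
  · obtain ⟨y, hy⟩ := exists_sgn_of_abs_eq_one (h k)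
    obtain ⟨z, hz⟩ := exists_sgn_of_abs_eq_one (h (finRotate N k))
    refine ⟨y + z + β.1 (.tri k), (p.edgeEq_iff_corr _ _).2 ?_⟩
    have h1 := tri_nonneg p k (y + 1) (z + 1)
    have e1 : ∀ y z b : ZMod 2, y + 1 + (z + 1) + b = y + z + b := by decide
    rw [hy, hz, e1, sgn_add y 1, sgn_add z 1, sgn_one] at h1
    have h2 := abs_le.1 (p.abs_corr_le (.rim k))
    have hyy := sgn_mul_self y
    have hzz := sgn_mul_self z
    rcases ZMod.eq_zero_or_one (y + z + β.1 (.tri k)) with h | h <;>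
      rw [h] at h1 ⊢ <;> simp at h1 ⊢ <;> linarith

/-- A direction `(w, w')` on the two interior edges of a triangle extends to the boundary edge
compatibly with the tight inequalities, provided that it vanishes on deterministic edges and
respects the correlation that is forced if the boundary edge is deterministic. -/
lemma exists_rim_direction {r u v w w' : ℝ} {t : ZMod 2}
    (hne : ∃ y z, 1 + (sgn (y + z + t) * r + sgn y * u + sgn z * v) = 0)
    (hu : |u| = 1 → w = 0) (hv : |v| = 1 → w' = 0)
    (hr : ∀ ε, r = sgn (ε + t) → w' = sgn ε * w) :
    ∃ ρ, ∀ y z, 1 + (sgn (y + z + t) * r + sgn y * u + sgn z * v) = 0 →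
      sgn (y + z + t) * ρ + sgn y * w + sgn z * w' = 0 := by
  obtain ⟨y, z, h⟩ := hne
  have hcase : ∀ a b : ZMod 2, b = a ∨ b = a + 1 := by decide
  have sy := sgn_mul_self y
  have sz := sgn_mul_self z
  refine ⟨-sgn (y + z + t) * (sgn y * w + sgn z * w'), fun y' z' h' => ?_⟩
  have ss := sgn_mul_self (y + z + t)
  rcases hcase y y' with rfl | rfl <;> rcases hcase z z' with rfl | rfl
  · linear_combination (-(sgn y' * w + sgn z' * w')) * ss
  · have e : y' + (z + 1) + t = y' + z + t + 1 := by ring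
    rw [e, sgn_add _ 1, sgn_add z 1, sgn_one] at h' ⊢
    have hu' : u = -sgn y' := by linear_combination sgn y' * (h + h') / 2 - u * sy
    rw [hu (by rw [hu', abs_neg, abs_sgn])]
    linear_combination (sgn z * w') * ss
  · have e : y + 1 + z' + t = y + z' + t + 1 := by ring
    rw [e, sgn_add _ 1, sgn_add y 1, sgn_one] at h' ⊢
    have hv' : v = -sgn z' := by linear_combination sgn z' * (h + h') / 2 - v * sz
    rw [hv (by rw [hv', abs_neg, abs_sgn])]
    linear_combination (sgn y * w) * ss
  · have e : ∀ y z t : ZMod 2, y + 1 + (z + 1) + t = y + z + t := by decide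
    rw [e, sgn_add y 1, sgn_add z 1, sgn_one] at h' ⊢
    have hr' : r = sgn (y + z + 1 + t) := by
      have e' : y + z + 1 + t = y + z + t + 1 := by ring
      rw [e', sgn_add _ 1, sgn_one]
      linear_combination sgn (y + z + t) * (h + h') / 2 - r * ss
    have hw := hr _ hr'
    rw [sgn_add, sgn_add, sgn_one] at hw
    rw [hw]
    linear_combination (sgn (y + z + t) * sgn (y + z + t) + 1) * sgn y * w * sz

/-- At a vertex, a direction on the interior edges vanishes if it vanishes on the deterministic
edges and respects the correlations forced by the deterministic boundary edges. -/
lemma eq_zero_of_tightDirs_eq_bot {p : TwistedDist (cycleSpace N i) β} (hp : p.tightDirs = ⊥)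
    {w : Fin N → ℝ} (hu : ∀ k, |p.corr (.spoke k)| = 1 → w k = 0)
    (hr : ∀ k ε, p.corr (.rim k) = sgn (ε + β.1 (.tri k)) → w (finRotate N k) = sgn ε * w k) :
    w = 0 := by
  rw [Submodule.eq_bot_iff] at hp
  have htight : ∀ k y z, p.prob (.tri k) (pairOf (i k) (β.1 (.tri k)) y z) = 0 ↔
      1 + (sgn (y + z + β.1 (.tri k)) * p.corr (.rim k) + sgn y * p.corr (.spoke k) +
        sgn z * p.corr (.spoke (finRotate N k))) = 0 := fun k y z => by
    rw [prob_pairOf]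
    simp
  -- Some inequality is tight on each triangle, since otherwise its boundary edge could be moved.
  have hne : ∀ k, ∃ y z, 1 + (sgn (y + z + β.1 (.tri k)) * p.corr (.rim k) +
      sgn y * p.corr (.spoke k) + sgn z * p.corr (.spoke (finRotate N k))) = 0 := by
    intro k
    by_contra! hno
    have := hp (Pi.single k 1, 0) fun l y z h => by
      have hl : l ≠ k := by
        rintro rfl
        exact hno y z ((htight l y z).1 h)
      simp [hl]
    simpa using congrFun (congrArg Prod.fst this) k
  choose ρ hρ using fun k => exists_rim_direction (hne k) (hu k) (hu (finRotate N k)) (hr k)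
  exact congrArg Prod.snd (hp (ρ, w) fun k y z h => hρ k y z ((htight k y z).1 h))

/-- At a vertex that is not deterministic all boundary edges are deterministic, and all interior
edges are uniformly random. -/
lemma corr_of_tightDirs_eq_bot {p : TwistedDist (cycleSpace N i) β} (hp : p.tightDirs = ⊥)
    (hdet : ¬ p.IsDeterministic) :
    (∀ k, |p.corr (.rim k)| = 1) ∧ ∀ k, p.corr (.spoke k) = 0 := by
  have hdet' : ¬ ∀ k, |p.corr (.spoke k)| = 1 := fun h => hdet (isDeterministic_of_abs_corr_spoke h)
  have hrim : ∀ j, |p.corr (.rim j)| = 1 := by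
    intro j
    by_contra hj
    -- Cut the cycle open at `j`; then the signs demanded by the other triangles can be met.
    let e : Fin N → ZMod 2 := fun k => if p.corr (.rim k) = sgn (β.1 (.tri k)) then 0 else 1
    have hsum : ∑ k, (e k + if k = j then ∑ l, e l else 0) = 0 := by
      rw [Finset.sum_add_distrib, Finset.sum_ite_eq' Finset.univ j, if_pos (Finset.mem_univ j),
        CharTwo.add_self_eq_zero]
    obtain ⟨t, ht⟩ := exists_potential hsum
    have hw := eq_zero_of_tightDirs_eq_bot hp
      (w := fun k => sgn (t k) * (1 - |p.corr (.spoke k)|)) (fun k h => by simp [h])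
      (fun k ε h => by
        have hk : k ≠ j := by
          rintro rfl
          exact hj (by rw [h, abs_sgn])
        have he : e k = ε := by
          simp only [e, h]
          rcases ZMod.eq_zero_or_one ε with rfl | rfl
          · simp
          · refine if_neg fun h' => ?_
            simpa using sgn_injective h'
        have htk := ht k
        rw [if_neg hk, add_zero, he] at htk
        have : t (finRotate N k) = ε + t k := by
          rw [← htk, add_right_comm, CharTwo.add_self_eq_zero, zero_add]
        rw [abs_corr_spoke_finRotate (by rw [h, abs_sgn]), this, sgn_add]
        ring)
    refine hdet' fun k => ?_
    have := congrFun hw k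
    have := (mul_eq_zero.1 this).resolve_left (sgn_ne_zero _)
    linarith
  refine ⟨hrim, fun k => ?_⟩
  -- Otherwise the correlations on the interior edges could be scaled.
  have hw := eq_zero_of_tightDirs_eq_bot hp
    (w := fun k => p.corr (.spoke k) * (1 - |p.corr (.spoke k)|)) (fun k h => by simp [h])
    (fun k ε h => by
      have h2 := corr_spoke_finRotate h
      have e1 : ∀ b ε : ZMod 2, b + (ε + b) = ε := by decide
      rw [e1] at h2
      rw [abs_corr_spoke_finRotate (hrim k), h2]
      ring)
  refine (mul_eq_zero.1 (congrFun hw k)).resolve_right fun h1 => hdet' fun l => ?_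
  rw [eq_of_finRotate_invariant (f := fun k => |p.corr (.spoke k)|)
    (fun k => abs_corr_spoke_finRotate (hrim k)) l k]
  linarith

/-! ### Distributions that are deterministic exactly on the boundary -/

lemma boundaryEq_iff {p : TwistedDist (cycleSpace N i) β} {a : Fin N → ZMod 2} :
    BoundaryEq p a ↔ ∀ k, p.corr (.rim k) = sgn (a k) :=
  forall_congr' fun _ => p.edgeEq_iff_corr _ _

/-- If the boundary edges are deterministic and the interior edges are not, then the tight
directions are those along which the interior edges keep their correlations. -/
lemma mem_tightDirs_iff {p : TwistedDist (cycleSpace N i) β} {a : Fin N → ZMod 2}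
    (ha : BoundaryEq p a) (hu : ∀ k, |p.corr (.spoke k)| ≠ 1) {d : (Fin N → ℝ) × (Fin N → ℝ)} :
    d ∈ p.tightDirs ↔
      d.1 = 0 ∧ ∀ k, d.2 (finRotate N k) = sgn (β.1 (.tri k) + a k) * d.2 k := by
  rw [boundaryEq_iff] at ha
  -- Exactly the pairs that contradict the correlation forced by the boundary edge are impossible.
  have htight : ∀ k y z, p.prob (.tri k) (pairOf (i k) (β.1 (.tri k)) y z) = 0 ↔
      z = β.1 (.tri k) + a k + y + 1 := fun k y z => by
    have e1 : ∀ b a y z : ZMod 2, z = b + a + y ∨ z = b + a + y + 1 := by decide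
    have e2 : ∀ b a y : ZMod 2, y + (b + a + y) + b = a := by decide
    have e3 : ∀ b a y : ZMod 2, y + (b + a + y + 1) + b = a + 1 := by decide
    have s1 := sgn_mul_self (a k)
    have s2 := sgn_mul_self (β.1 (.tri k) + a k)
    have s3 := sgn_mul_self y
    rw [prob_pairOf, corr_spoke_finRotate (ha k), ha k]
    rcases e1 (β.1 (.tri k)) (a k) y z with rfl | rfl
    · rw [e2, sgn_add _ y]
      simp only [left_eq_add, one_ne_zero, iff_false]
      intro h0
      have : p.corr (.spoke k) = -sgn y := by
        linear_combination 2 * sgn y * h0 - sgn y / 2 * s1 -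
          (1 / 2 * p.corr (.spoke k) * sgn y * sgn y) * s2 - p.corr (.spoke k) * s3
      exact hu k (by rw [this, abs_neg, abs_sgn])
    · rw [e3, sgn_add _ 1, sgn_add _ 1, sgn_add _ y, sgn_one]
      simp only [iff_true]
      linear_combination -1 / 4 * s1 - (1 / 4 * p.corr (.spoke k) * sgn y) * s2
  have e3 : ∀ b a y : ZMod 2, y + (b + a + y + 1) + b = a + 1 := by decide
  have e4 : ∀ b a : ZMod 2, 0 + (b + a + 1) + b = a + 1 := by decide
  constructor
  · intro hd
    have h0 := fun k => hd k 0 _ ((htight k 0 _).2 rfl)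
    have h1 := fun k => hd k 1 _ ((htight k 1 _).2 rfl)
    simp only [e3, e4, sgn_add _ (1 : ZMod 2), sgn_one, sgn_zero, add_zero] at h0 h1
    refine ⟨funext fun k => ?_, fun k => ?_⟩
    · have s1 := sgn_mul_self (a k)
      have h0 := h0 k
      have h1 := h1 k
      have : sgn (a k) * d.1 k = 0 := by linarith
      exact (mul_eq_zero.1 this).resolve_left (sgn_ne_zero _)
    · have s1 := sgn_mul_self (β.1 (.tri k) + a k)
      have h0 := h0 k
      have h1 := h1 k
      have h2 : d.2 k = sgn (β.1 (.tri k) + a k) * d.2 (finRotate N k) := by linarith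
      rw [h2]
      linear_combination -d.2 (finRotate N k) * s1
  · rintro ⟨h1, h2⟩ k y z h
    rw [(htight k y z).1 h, h1, h2, sgn_add _ 1, sgn_add _ y, sgn_one, Pi.zero_apply]
    have s1 := sgn_mul_self (β.1 (.tri k) + a k)
    linear_combination (-sgn y * d.2 k) * s1

lemma cycleClass_add_sum (β : (cycleSpace N i).C2) (a : Fin N → ZMod 2) :
    cycleClass β + ∑ k, a k = ∑ k, (β.1 (.tri k) + a k) :=
  Finset.sum_add_distrib.symm

lemma tightDirs_eq_bot {p : TwistedDist (cycleSpace N i) β} {a : Fin N → ZMod 2}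
    (ha : BoundaryEq p a) (hu : ∀ k, |p.corr (.spoke k)| ≠ 1)
    (hs : cycleClass β + ∑ k, a k = 1) : p.tightDirs = ⊥ := by
  rw [Submodule.eq_bot_iff]
  intro d hd
  obtain ⟨h1, h2⟩ := (mem_tightDirs_iff ha hu).1 hd
  exact Prod.ext h1 (eq_zero_of_sgn_mul ((cycleClass_add_sum β a).symm.trans hs) h2)

lemma finrank_tightDirs_eq_one (hN : 0 < N) {p : TwistedDist (cycleSpace N i) β}
    {a : Fin N → ZMod 2} (ha : BoundaryEq p a) (hu : ∀ k, |p.corr (.spoke k)| ≠ 1)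
    (hs : cycleClass β + ∑ k, a k = 0) : Module.finrank ℝ p.tightDirs = 1 := by
  obtain ⟨t, ht⟩ := exists_potential ((cycleClass_add_sum β a).symm.trans hs)
  have hmem : ((0, fun k => sgn (t k)) : (Fin N → ℝ) × (Fin N → ℝ)) ∈ p.tightDirs :=
    (mem_tightDirs_iff ha hu).2 ⟨rfl, fun k => by
      simp only [← ht, sgn_add]
      linear_combination -sgn (t (finRotate N k)) * sgn_mul_self (t k)⟩
  rw [finrank_eq_one_iff']
  refine ⟨⟨_, hmem⟩, fun h => ?_, fun ⟨d, hd⟩ => ?_⟩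
  · have := congrFun (congrArg Prod.snd (congrArg Subtype.val h)) ⟨0, hN⟩
    exact sgn_ne_zero _ this
  · obtain ⟨h1, h2⟩ := (mem_tightDirs_iff ha hu).1 hd
    obtain ⟨c, hc⟩ := exists_eq_mul_sgn ht h2
    exact ⟨c, Subtype.ext (Prod.ext (by simp [h1]) (funext fun k => (hc k).symm))⟩

/-- With deterministic boundary edges whose outcomes have the odd total demanded by `β`, the
interior edges are uniformly random. -/
lemma corr_spoke_eq_zero {p : TwistedDist (cycleSpace N i) β} {a : Fin N → ZMod 2}
    (ha : BoundaryEq p a) (hs : cycleClass β + ∑ k, a k = 1) (k : Fin N) :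
    p.corr (.spoke k) = 0 :=
  congrFun (eq_zero_of_sgn_mul (w := fun k => p.corr (.spoke k))
    ((cycleClass_add_sum β a).symm.trans hs)
    fun k => corr_spoke_finRotate (boundaryEq_iff.1 ha k)) k

/-! ### The deterministic part -/

lemma spoke_notMem_cycleBoundary (k : Fin N) : CycleEdge.spoke k ∉ (cycleBoundary N i).S1 := by
  -- The edges that are not interior, and the triangles with such faces, form a simplicial subset.
  let Z : Sub (cycleSpace N i) :=
    { S0 := Set.univ
      S1 := {x | ∀ k, x ≠ .spoke k}
      S2 := {σ | ∀ l k, cycleD2 i l σ ≠ .spoke k}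
      d1_mem := fun _ _ _ => trivial
      d2_mem := fun l _ h => h l
      s0_mem := fun _ _ _ h => by cases h
      s1_mem := by
        rintro j (v | m | m) hx l k h
        · cases h
        · exact hx m rfl
        · change cycleDegFace i j (.rim m) l = _ at h
          fin_cases j <;> fin_cases l <;> cases h }
  exact fun h => h Z (by rintro _ ⟨m, rfl⟩ k h; cases h) (Set.empty_subset _) k rfl

lemma abs_corr_spoke_ne_one {p : TwistedDist (cycleSpace N i) β}
    (h : p.detPart = cycleBoundary N i) (k : Fin N) : |p.corr (.spoke k)| ≠ 1 := by
  intro h1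
  obtain ⟨a, ha⟩ := exists_sgn_of_abs_eq_one h1
  have : CycleEdge.spoke k ∈ p.detPart.S1 := fun Z hZ _ =>
    hZ ⟨fun _ h => by (cases h), a, (p.edgeEq_iff_corr _ _).2 ha⟩
  exact spoke_notMem_cycleBoundary k (h ▸ this)

lemma detPart_eq_cycleBoundary {p : TwistedDist (cycleSpace N i) β} {a : Fin N → ZMod 2}
    (ha : BoundaryEq p a) (hu : ∀ k, |p.corr (.spoke k)| ≠ 1) :
    p.detPart = cycleBoundary N i := by
  have hspoke : ∀ k a, ¬ p.EdgeEq (.spoke k) a := fun k a h =>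
    hu k (by rw [(p.edgeEq_iff_corr _ _).1 h, abs_sgn])
  have h1 : {x | (cycleSpace N i).Nondeg1 x ∧ ∃ a, p.EdgeEq x a} =
      Set.range (CycleEdge.rim : Fin N → CycleEdge N) := by
    ext x
    constructor
    · rintro ⟨hx, b, hb⟩
      rcases x with v | k | k
      exacts [(hx v rfl).elim, (hspoke k b hb).elim, ⟨k, rfl⟩]
    · rintro ⟨k, rfl⟩
      exact ⟨fun _ h => by (cases h), a k, ha k⟩
  have h2 : {σ | (cycleSpace N i).Nondeg2 σ ∧ ∃ ab, p.TriEq σ ab} = ∅ := by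
    rw [Set.eq_empty_iff_forall_notMem]
    rintro σ ⟨hσ, ab, hab⟩
    obtain ⟨k, rfl⟩ := cycleSpace_nondeg2_iff.1 hσ
    have := p.edgeEq_d2 hab (i k).castSucc
    have hface : cycleD2 i (i k).castSucc (.tri k) = .spoke k := by
      obtain h | h : i k = 0 ∨ i k = 1 := by omega
      all_goals simp [cycleD2, h]
    change p.EdgeEq (cycleD2 i (i k).castSucc (.tri k)) _ at this
    rw [hface] at this
    exact hspoke k _ this
  unfold detPart cycleBoundary
  rw [h1, h2]

/-! ### The class of the quotient cocycle -/

lemma coboundary_tri (t : (cycleSpace N i).C1) (k : Fin N) :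
    ((cycleSpace N i).coboundary t).1 (.tri k) =
      t.1 (.spoke k) + t.1 (.spoke (finRotate N k)) + t.1 (.rim k) := by
  change t.1 (cycleD2 i 0 (.tri k)) - t.1 (cycleD2 i 1 (.tri k)) + t.1 (cycleD2 i 2 (.tri k)) = _
  rw [CharTwo.sub_eq_add]
  obtain h | h : i k = 0 ∨ i k = 1 := by omega
  · simp [cycleD2, h]
  · simp [cycleD2, h, add_comm]

lemma quotCocycle_tri {p : TwistedDist (cycleSpace N i) β} {a : Fin N → ZMod 2}
    (h : p.detPart = cycleBoundary N i) (ha : BoundaryEq p a) (k : Fin N) :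
    p.quotCocycle.1 (Quot.mk _ (.tri k)) = β.1 (.tri k) + a k := by
  have hspoke : ∀ k, p.extCochain.1 (.spoke k) = 0 := fun k =>
    if_neg fun h' => spoke_notMem_cycleBoundary k (h ▸ h'.1)
  have hrim : CycleEdge.rim k ∈ p.detPart.S1 := fun Z hZ _ =>
    hZ ⟨fun _ h => by (cases h), a k, ha k⟩
  change β.1 (.tri k) + ((cycleSpace N i).coboundary p.extCochain).1 (.tri k) = _
  rw [coboundary_tri, hspoke, hspoke, p.extCochain_eq hrim (ha k), add_zero, zero_add]

/-- A cochain on the quotient is a cochain on the interior edges, so the cohomology of the quotient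
is the first cohomology of the cycle formed by the triangles. -/
lemma cohClass_quotCocycle_eq_zero_iff {p : TwistedDist (cycleSpace N i) β} {a : Fin N → ZMod 2}
    (h : p.detPart = cycleBoundary N i) (ha : BoundaryEq p a) :
    cohClass p.quotCocycle = 0 ↔ cycleClass β + ∑ k, a k = 0 := by
  rw [cohClass, Submodule.Quotient.mk_eq_zero, cycleClass_add_sum, LinearMap.mem_range]
  constructor
  · rintro ⟨T, hT⟩
    let t : (cycleSpace N i).C1 := ⟨fun x => T.1 (Quot.mk _ x), fun v => T.2 (Quot.mk _ v)⟩
    have hrim : ∀ k, t.1 (.rim k) = 0 := fun k => by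
      have h1 : CycleEdge.rim k ∈ p.detPart.S1 := fun Z hZ _ =>
        hZ ⟨fun _ h => by (cases h), a k, ha k⟩
      have h2 : CycleEdge.const (cycleD1 i 0 (.rim k)) ∈ p.detPart.S1 :=
        p.detPart.s0_mem _ (p.detPart.d1_mem 0 _ h1)
      have h3 : t.1 (.rim k) = t.1 (.const (cycleD1 i 0 (.rim k))) :=
        congrArg T.1 (Quot.sound ⟨h1, h2⟩)
      rw [h3]
      exact t.2 _
    have htri : ∀ k, β.1 (.tri k) + a k = t.1 (.spoke k) + t.1 (.spoke (finRotate N k)) :=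
      fun k => by
        rw [← quotCocycle_tri h ha, ← hT]
        exact (coboundary_tri t k).trans (by rw [hrim, add_zero])
    simp only [htri, Finset.sum_add_distrib]
    rw [Equiv.sum_comp (finRotate N) fun k => t.1 (.spoke k), CharTwo.add_self_eq_zero]
  · intro hs
    obtain ⟨t, ht⟩ := exists_potential hs
    let t' : (cycleSpace N i).C1 := ⟨fun x => match x with
      | .spoke k => t k
      | _ => 0, fun _ => rfl⟩
    have h0 : ∀ x ∈ p.detPart.S1, t'.1 x = 0 := by
      rintro (v | k | k) hx
      exacts [rfl, (spoke_notMem_cycleBoundary k (h ▸ hx)).elim, rfl]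
    let T : ((cycleSpace N i).quot p.detPart).C1 :=
      ⟨Quot.lift t'.1 fun x y hxy => (h0 x hxy.1).trans (h0 y hxy.2).symm,
        Quot.ind fun v => t'.2 v⟩
    refine ⟨T, Subtype.ext (funext (Quot.ind fun σ => ?_))⟩
    have hdeg : ∀ j x, (((cycleSpace N i).quot p.detPart).coboundary T).1
        (Quot.mk _ (cycleS1 j x)) = p.quotCocycle.1 (Quot.mk _ (cycleS1 j x)) := fun j x =>
      ((((cycleSpace N i).quot p.detPart).coboundary T).2 j (Quot.mk _ x)).trans
        (p.quotCocycle.2 j (Quot.mk _ x)).symm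
    rcases σ with v | ⟨j, k⟩ | ⟨j, k⟩ | k
    · exact hdeg 0 (.const v)
    · exact hdeg j (.spoke k)
    · exact hdeg j (.rim k)
    · rw [quotCocycle_tri h ha, ← ht]
      exact (coboundary_tri t' k).trans (add_zero _)

/-! ### Popescu–Rohrlich boxes -/

lemma prob_tri_of_corr_spoke_eq_zero {p : TwistedDist (cycleSpace N i) β}
    (hu : ∀ k, p.corr (.spoke k) = 0) (k : Fin N) (c b : ZMod 2) :
    p.prob (.tri k) (c, b) = (1 + sgn c * p.corr (.rim k)) / 4 := by
  obtain ⟨y, z, h⟩ := exists_pairOf_eq (i k) (β.1 (.tri k)) (c, b)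
  have hc : y + z + β.1 (.tri k) = c := congrArg Prod.fst h
  rw [← h, prob_pairOf, hu, hu, hc]
  ring

lemma boundaryEq_of_prob {p : TwistedDist (cycleSpace N i) β} {a : Fin N → ZMod 2}
    (h : ∀ k c b, p.prob (.tri k) (c, b) = if c = a k then 1 / 2 else 0) : BoundaryEq p a := by
  rw [boundaryEq_iff]
  intro k
  have hc : p.corr (.rim k) = bitCorr ((p.triDist (.tri k)).map (faceOutcome (β.1 (.tri k)) 2)) :=
    congrArg bitCorr (p.edgeDist_d2 2 (.tri k))
  rw [hc, bitCorr, StdSimplex.weights_map_apply, StdSimplex.weights_map_apply]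
  simp only [← prob_eq, Fintype.sum_prod_type, ZMod.sum_two, h, faceOutcome_two]
  rcases ZMod.eq_zero_or_one (a k) with h | h <;> simp [h] <;> norm_num

end TwoSSet.TwistedDist

open TwoSSet.TwistedDist

lemma isPRBox_iff {N : ℕ} {i : Fin N → Fin 2} {β : (cycleSpace N i).C2} (hβ : cycleClass β = 0)
    (p : TwistedDist (cycleSpace N i) β) :
    IsPRBox p ↔ ∃ a : Fin N → ZMod 2, BoundaryEq p a ∧ ∑ k, a k = 1 := by
  constructor
  · rintro ⟨a, hs, h⟩
    exact ⟨a, boundaryEq_of_prob h, hs⟩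
  · rintro ⟨a, ha, hs⟩
    refine ⟨a, hs, fun k c b => ?_⟩
    rw [prob_tri_of_corr_spoke_eq_zero (corr_spoke_eq_zero ha (by rw [hβ, hs, zero_add])),
      boundaryEq_iff.1 ha k]
    split_ifs with h
    · rw [h, sgn_mul_self]
      norm_num
    · have : ∀ a c : ZMod 2, c ≠ a → c = a + 1 := by decide
      rw [this _ _ h, sgn_add, sgn_one]
      linear_combination -1 / 4 * sgn_mul_self (a k)

theorem detPart_eq_of_isVertex {N : ℕ} {i : Fin N → Fin 2} {β : (cycleSpace N i).C2}
    {p : TwistedDist (cycleSpace N i) β} (hp : p.IsVertex) (hdet : ¬ p.IsDeterministic) :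
    p.detPart = cycleBoundary N i ∧ ∃ a : Fin N → ZMod 2, BoundaryEq p a := by
  obtain ⟨hr, hu⟩ := corr_of_tightDirs_eq_bot ((isVertex_iff p).1 hp) hdet
  choose a ha using fun k => exists_sgn_of_abs_eq_one (hr k)
  have ha' := boundaryEq_iff.2 ha
  exact ⟨detPart_eq_cycleBoundary ha' fun k => by simp [hu], a, ha'⟩

theorem isVertex_iff_of_detPart_eq {N : ℕ} (hN : 2 ≤ N) {i : Fin N → Fin 2}
    {β : (cycleSpace N i).C2} {p : TwistedDist (cycleSpace N i) β} {a : Fin N → ZMod 2}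
    (h : p.detPart = cycleBoundary N i) (ha : BoundaryEq p a) :
    p.IsVertex ↔ cycleClass β + ∑ k, a k = 1 := by
  have hu := abs_corr_spoke_ne_one h
  rw [isVertex_iff]
  refine ⟨fun hp => ?_, tightDirs_eq_bot ha hu⟩
  refine (ZMod.eq_zero_or_one _).resolve_left fun hs => ?_
  have := finrank_tightDirs_eq_one (by omega) ha hu hs
  rw [hp, finrank_bot] at this
  exact zero_ne_one this

end

theorem mainTheorem6 (N : ℕ) (hN : 2 ≤ N) (i : Fin N → Fin 2) (β : (cycleSpace N i).C2) :
    -- a vertex that is not deterministic is deterministic exactly on the boundary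
    (∀ p : TwoSSet.TwistedDist (cycleSpace N i) β, p.IsVertex → ¬ p.IsDeterministic →
      p.detPart = cycleBoundary N i ∧ ∃ a : Fin N → ZMod 2, BoundaryEq p a) ∧
    -- rank and vertex criterion for the distributions that are deterministic exactly there
    (∀ (p : TwoSSet.TwistedDist (cycleSpace N i) β) (a : Fin N → ZMod 2),
      p.detPart = cycleBoundary N i → BoundaryEq p a →
        (TwoSSet.cohClass p.quotCocycle = 0 ↔ cycleClass β + ∑ k, a k = 0) ∧
        (TwoSSet.cohClass p.quotCocycle ≠ 0 → p.rank = 2 * N) ∧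
        (TwoSSet.cohClass p.quotCocycle = 0 → p.rank = 2 * N - 1) ∧
        (p.IsVertex ↔ TwoSSet.cohClass p.quotCocycle ≠ 0) ∧
        (p.IsVertex ↔ cycleClass β = 1 + ∑ k, a k) ∧
        (cycleClass β = 0 → (p.IsVertex ↔ ∑ k, a k = 1))) ∧
    -- the case of the PR boxes
    (N = 4 → β = 0 → ∀ p : TwoSSet.TwistedDist (cycleSpace N i) β,
      (p.IsVertex ∧ ¬ p.IsDeterministic ↔ IsPRBox p) ∧
      (IsPRBox p ↔ ∃ a : Fin N → ZMod 2, BoundaryEq p a ∧ ∑ k, a k = 1)) := by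
  have hne : ∀ s : ZMod 2, s ≠ 0 ↔ s = 1 := by decide
  refine ⟨fun p => detPart_eq_of_isVertex, fun p a h ha => ?_, fun _ hβ p => ?_⟩
  · have hu := TwoSSet.TwistedDist.abs_corr_spoke_ne_one h
    have hcoh := TwoSSet.TwistedDist.cohClass_quotCocycle_eq_zero_iff h ha
    have hvert := isVertex_iff_of_detPart_eq hN h ha
    have hrank := TwoSSet.TwistedDist.rank_add_finrank_tightDirs hN p
    refine ⟨hcoh, fun hc => ?_, fun hc => ?_, ?_, ?_, fun hβ => ?_⟩
    · rw [Ne, hcoh, ← Ne, hne] at hc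
      rw [TwoSSet.TwistedDist.tightDirs_eq_bot ha hu hc, finrank_bot] at hrank
      exact hrank
    · rw [TwoSSet.TwistedDist.finrank_tightDirs_eq_one (by omega) ha hu (hcoh.1 hc)] at hrank
      omega
    · rw [hvert, Ne, hcoh, ← Ne, hne]
    · rw [hvert]
      generalize ∑ k, a k = s
      generalize cycleClass β = c
      revert s c
      decide
    · rw [hvert, hβ, zero_add]
  · have hβ0 : cycleClass β = 0 := by
      subst hβ
      exact Finset.sum_const_zero
    have hPR := isPRBox_iff hβ0 p
    refine ⟨?_, hPR⟩
    rw [hPR]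
    constructor
    · rintro ⟨hp, hdet⟩
      obtain ⟨h, a, ha⟩ := detPart_eq_of_isVertex hp hdet
      refine ⟨a, ha, ?_⟩
      have := (isVertex_iff_of_detPart_eq hN h ha).1 hp
      rwa [hβ0, zero_add] at this
    · rintro ⟨a, ha, hs⟩
      have hs' : cycleClass β + ∑ k, a k = 1 := by rw [hβ0, hs, zero_add]
      have hu := TwoSSet.TwistedDist.corr_spoke_eq_zero ha hs'
      have h := TwoSSet.TwistedDist.detPart_eq_cycleBoundary ha fun k => by simp [hu]
      refine ⟨(isVertex_iff_of_detPart_eq hN h ha).2 hs', fun hdet => ?_⟩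
      obtain ⟨c, hc⟩ := hdet.exists_edgeEq (.spoke ⟨0, by omega⟩)
      rw [TwoSSet.TwistedDist.edgeEq_iff_corr, hu] at hc
      exact TwoSSet.TwistedDist.sgn_ne_zero c hc.symm
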